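/- Fix $\lambda$ colors. A network is a finite directed network (parallel arcs and loops allowed) in which each arc has one of the colors $1,\dots,\lambda$. Let $G^0$ be a network and, for each color $i$, let $R_{i1},\dots,R_{iq_i}$ be networks, each with two distinct distinguished nodes $A$ and $B$, and let $p_{i1},\dots,p_{iq_i}\ge 0$ be probabilities with $\sum_{k=1}^{q_i}p_{ik}=1$. Given $G^t$, the network $G^{t+1}$ is obtained by simultaneously replacing each arc $e$ of $G^t$, of color $i$ say, by a new copy of $R_{ik}$, where $k$ is chosen with probability $p_{ik}$, independently for all arcs and all steps; the nodes $A$ and $B$ of the copy are identified with the beginning node and the ending node of $e$, respectively, and its other nodes are new. Let $\Gamma=(G^0,G^1,G^2,\dots)$ be the resulting random sequence, and let $|E(G^t)|$ be the number of arcs of $G^t$. Let $\mathbf M=(\overline m_{ij})$ be the $\lambda\times\lambda$ matrix with entries $$\overline m_{ij}=\sum_{k=1}^{q_i}p_{ik}\,\bigl|\{j\text{-colored arcs of }R_{ik}\}\bigr|,$$ and let $\rho(\mathbf M)$ be its spectral radius. **Theorem.** Suppose that $G^0$ has at least one arc, that every $R_{ik}$ with $p_{ik}>0$ has at least one arc,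 and that $\mathbf M$ is primitive (that is, $\mathbf M$ is non-negative and $\mathbf M^m$ has only positive entries for some integer $m\ge1$). Then, for almost every realisation $\Gamma$, there is a constant $c>0$ (which may depend on $\Gamma$) such that $$\lim_{t\to\infty}\frac{|E(G^t)|}{\rho(\mathbf M)^t}=c .$$ -/

import Mathlib

open Filter Topology MeasureTheory

/-- A finite directed network whose arcs carry one of `n` colors.  Parallel arcs and loops are
allowed. -/
structure ColoredNetwork (n : ℕ) where
  /-- the nodes -/
  V : Type
  /-- the arcs -/
  E : Type
  finV : Finite V
  finE : Finite E
  /-- beginning node of an arc -/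
  src : E → V
  /-- ending node of an arc -/
  tgt : E → V
  /-- color of an arc -/
  col : E → Fin n

attribute [instance] ColoredNetwork.finV ColoredNetwork.finE

/-- A network with two distinguished distinct nodes `A` and `B`, which is to replace an arc. -/
structure ReplacementNetwork (n : ℕ) extends ColoredNetwork n where
  A : V
  B : V
  A_ne_B : A ≠ B

namespace ColoredNetwork

variable {n : ℕ}

/-- The number of `j`-colored arcs, the `j`-th entry of `χ(G)`. -/
noncomputable def chi (G : ColoredNetwork n) (j : Fin n) : ℕ :=
  Nat.card {e : G.E // G.col e = j}

/-- The number of arcs. -/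
noncomputable def numArcs (G : ColoredNetwork n) : ℕ :=
  Nat.card G.E

/-- The nodes after every arc `e` of `G` is replaced by `R e`: the old nodes, together with
a separate copy of the nodes of `R e` other than `A`, `B` for every arc `e`. -/
def SubstNode (G : ColoredNetwork n) (R : G.E → ReplacementNetwork n) : Type :=
  G.V ⊕ (Σ e : G.E, {v : (R e).V // v ≠ (R e).A ∧ v ≠ (R e).B})

open Classical in
/-- The node of the new network that a node `v` of `R e` becomes: `A` and `B` respectively become
the beginning and the ending node of `e`. -/
noncomputable def glue (G : ColoredNetwork n) (R : G.E → ReplacementNetwork n) (e : G.E)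
    (v : (R e).V) : G.SubstNode R :=
  if h : v ≠ (R e).A ∧ v ≠ (R e).B then Sum.inr ⟨e, v, h⟩
  else if v = (R e).A then Sum.inl (G.src e) else Sum.inl (G.tgt e)

/-- The network obtained from `G` by simultaneously replacing every arc `e` by `R e`. -/
noncomputable def subst (G : ColoredNetwork n) (R : G.E → ReplacementNetwork n) :
    ColoredNetwork n where
  V := G.SubstNode R
  E := Σ e : G.E, (R e).E
  finV := inferInstanceAs
    (Finite (G.V ⊕ (Σ e : G.E, {v : (R e).V // v ≠ (R e).A ∧ v ≠ (R e).B})))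
  finE := inferInstance
  src := fun x => G.glue R x.1 ((R x.1).src x.2)
  tgt := fun x => G.glue R x.1 ((R x.1).tgt x.2)
  col := fun x => (R x.1).col x.2

end ColoredNetwork

/-- The data of a random colored substitution network with `n` colors: the initial network `G0`
and, for every color `i`, the `q i` networks `R i k`, where `R i k` is chosen with
probability `p i k`. -/
structure SubstitutionSystem (n : ℕ) where
  G0 : ColoredNetwork n
  q : Fin n → ℕ
  R : (i : Fin n) → Fin (q i) → ReplacementNetwork n
  p : (i : Fin n) → PMF (Fin (q i))

namespace SubstitutionSystem

variable {n : ℕ} (S : SubstitutionSystem n)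

/-- The matrix of the mean numbers of `j`-colored arcs that replace an `i`-colored arc. -/
noncomputable def arcMatrix : Matrix (Fin n) (Fin n) ℝ :=
  Matrix.of fun i j => ∑ k : Fin (S.q i), (S.p i k).toReal * ((S.R i k).chi j : ℝ)

/-- Names for arcs.  An arc of the `t`-th network is named by its ancestor in `G0` and the list
(latest first) of the `t` arcs of networks `R i k` that it descends through. -/
abbrev Label : Type :=
  S.G0.E × List (Σ i : Fin n, Σ k : Fin (S.q i), (S.R i k).E)

/-- The sample space: for every name of an arc and every color `i`, the index of the network that
replaces the arc of that name if it occurs and has color `i`. -/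
abbrev Sample : Type :=
  (s : S.Label × Fin n) → Fin (S.q s.2)

/-- The law of the choices: they are all independent, and a choice for color `i` has
law `p i`. -/
noncomputable def law : Measure S.Sample :=
  Measure.infinitePi fun s : S.Label × Fin n => (S.p s.2).toMeasure

/-- A network whose arcs are named. -/
structure NamedNetwork where
  net : ColoredNetwork n
  name : net.E → S.Label

variable {S}

/-- The index of the network that replaces the arc `e`. -/
def NamedNetwork.choice (N : S.NamedNetwork) (ω : S.Sample) (e : N.net.E) :
    Fin (S.q (N.net.col e)) :=
  ω (N.name e, N.net.col e)

/-- One step: every arc `e`, of color `i`, is replaced by `R i k`, where `k` is the choice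
for `e`. -/
noncomputable def NamedNetwork.step (N : S.NamedNetwork) (ω : S.Sample) : S.NamedNetwork where
  net := N.net.subst fun e => S.R (N.net.col e) (N.choice ω e)
  name := fun x =>
    ((N.name x.1).1, ⟨N.net.col x.1, N.choice ω x.1, x.2⟩ :: (N.name x.1).2)

variable (S)

/-- The networks `G^0, G^1, G^2, …` with named arcs. -/
noncomputable def namedNetwork (ω : S.Sample) : ℕ → S.NamedNetwork
  | 0 => { net := S.G0, name := fun e => (e, []) }
  | t + 1 => (namedNetwork ω t).step ω

/-- Distinct arcs of `G^t` have distinct names, so their replacements are chosen independently. -/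
theorem name_injective (ω : S.Sample) (t : ℕ) :
    Function.Injective (S.namedNetwork ω t).name := by
  induction t with
  | zero =>
    intro e f h
    exact congrArg Prod.fst h
  | succ t ih =>
    rintro ⟨e, x⟩ ⟨f, y⟩ h
    obtain ⟨h1, h2⟩ := Prod.mk.inj h
    obtain ⟨h3, h4⟩ := List.cons.inj h2
    obtain rfl : e = f := ih (Prod.ext h1 h4)
    have h5 := eq_of_heq (Sigma.mk.inj h3).2
    have h6 := eq_of_heq (Sigma.mk.inj h5).2
    exact Sigma.ext rfl (heq_of_eq h6)

/-- The arcs of `G^t` are named by lists of length `t`, so the choices of different steps are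
independent. -/
theorem name_length (ω : S.Sample) (t : ℕ) (e : (S.namedNetwork ω t).net.E) :
    ((S.namedNetwork ω t).name e).2.length = t := by
  induction t with
  | zero => rfl
  | succ t ih => exact congrArg Nat.succ (ih e.1)

/-- The realisation `Γ = (G^0, G^1, G^2, …)` that belongs to the sample `ω`. -/
noncomputable def realisation (ω : S.Sample) (t : ℕ) : ColoredNetwork n :=
  (S.namedNetwork ω t).net

end SubstitutionSystem

/-- The spectral radius of a real square matrix: the largest modulus of a complex eigenvalue. -/
noncomputable def Matrix.specRadius {n : ℕ} (X : Matrix (Fin n) (Fin n) ℝ) : ℝ :=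
  (spectralRadius ℂ (X.map (algebraMap ℝ ℂ))).toReal

/-- `f ≍ g` along `l`: the quotient `f / g` tends to a positive constant. -/
def AsympConst {α : Type*} (l : Filter α) (f g : α → ℝ) : Prop :=
  ∃ c : ℝ, 0 < c ∧ Tendsto (fun x => f x / g x) l (𝓝 c)

/-! Let `v` be a positive eigenvector of M (Perron); its eigenvalue `r` is the spectral radius. If
each arc is weighted by the `v`-entry of its color, the total weight divided by `r ^ t` is a
martingale. Since every arc is replaced by at least one arc, the row sums of M are at least 1 and `r
≥ 1`.

If `r = 1`, Perron forces all row sums to be 1. The number of arcs is then almost surely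
nondecreasing with constant mean, hence constant.

If `r > 1`, the conditional variance of one step is at most proportional to the number of arcs, so
the one-step deviations divided by `r ^ t` are almost surely absolutely summable
(`ae_summable_inc`). The weight for any color function `f` is the weight of `M ^ t f` on the initial
network plus past deviations propagated by powers of M. As `M ^ k f / r ^ k` tends to a multiple `c
v`, dominated convergence gives the limit `c * W` with one `W` for all `f`
(`exists_tendsto_wt_div`).

For `W ≠ 0`: given weight `w` at time `t`, the relative variance of the future is at most `K / w`,
so the limit vanishes with probability at most `K E[1 / w]` (`measure_tendsto_zero_le`). This tends
to 0, because the number of arcs never decreases and leaves every bounded range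
(`tendsto_integral_inv_wt`).

Conditioning on time `t` is expressed by integrating against functions `φ` with `Past t φ`. -/

namespace Matrix

/-! ### Perron theory of primitive matrices. -/

variable {ι : Type*} [Fintype ι]

theorem mulVec_nonneg_of_nonneg {A : Matrix ι ι ℝ} (hA : ∀ i j, 0 ≤ A i j) {x : ι → ℝ}
    (hx : ∀ i, 0 ≤ x i) (i : ι) : 0 ≤ (A *ᵥ x) i :=
  Finset.sum_nonneg fun j _ => mul_nonneg (hA i j) (hx j)

theorem mulVec_pos_of_pos {A : Matrix ι ι ℝ} (hA : ∀ i j, 0 < A i j) {x : ι → ℝ}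
    (hx : ∀ i, 0 ≤ x i) (hx0 : x ≠ 0) (i : ι) : 0 < (A *ᵥ x) i := by
  obtain ⟨j, hj⟩ := Function.ne_iff.mp hx0
  exact Finset.sum_pos' (fun j _ => mul_nonneg (hA i j).le (hx j))
    ⟨j, Finset.mem_univ j, mul_pos (hA i j) (lt_of_le_of_ne (hx j) (Ne.symm hj))⟩

theorem exists_pos_forall_mul_le {a : ι → ℝ} (ha : ∀ i, 0 < a i) (b : ι → ℝ) :
    ∃ ε : ℝ, 0 < ε ∧ ∀ i, ε * b i ≤ a i := by
  have h : ∀ᶠ ε : ℝ in 𝓝[>] 0, ∀ i, ε * b i < a i := by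
    rw [eventually_all]
    intro i
    have hc : Tendsto (fun ε : ℝ => ε * b i) (𝓝 0) (𝓝 (0 * b i)) :=
      (continuous_id.mul continuous_const).tendsto 0
    rw [zero_mul] at hc
    exact (hc.eventually_lt_const (ha i)).filter_mono nhdsWithin_le_nhds
  obtain ⟨ε, hε, h0⟩ := (h.and self_mem_nhdsWithin).exists
  exact ⟨ε, h0, fun i => (hε i).le⟩

variable [DecidableEq ι]

theorem pow_mulVec_of_eigen {R : Type*} [CommSemiring R] {A : Matrix ι ι R} {v : ι → R} {r : R}
    (h : A *ᵥ v = r • v) (k : ℕ) : (A ^ k) *ᵥ v = r ^ k • v := by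
  induction k with
  | zero => simp
  | succ k ih => rw [pow_succ, ← mulVec_mulVec, h, mulVec_smul, ih, smul_smul, pow_succ']

/-- **Perron's theorem**, existence part: a primitive matrix has a positive eigenvector, with
positive eigenvalue. -/
theorem IsPrimitive.exists_pos_eigenvector [Nonempty ι] {A : Matrix ι ι ℝ} (hA : A.IsPrimitive) :
    ∃ (r : ℝ) (v : ι → ℝ), 0 < r ∧ (∀ i, 0 < v i) ∧ A *ᵥ v = r • v := by
  obtain ⟨hA0, m, hm, hpos⟩ := hA
  set C : ℝ := ∑ i, ∑ j, A i j with hC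
  -- Bounding `r` makes the set of pairs with `r x ≤ A x` compact, so a largest such `r` exists
  -- (Collatz–Wielandt).
  have hbound : ∀ (r : ℝ) (x : ι → ℝ), x ∈ stdSimplex ℝ ι → (∀ i, r * x i ≤ (A *ᵥ x) i) →
      r ≤ C := by
    intro r x hx h
    calc r = ∑ i, r * x i := by rw [← Finset.mul_sum, hx.2, mul_one]
      _ ≤ ∑ i, (A *ᵥ x) i := Finset.sum_le_sum fun i _ => h i
      _ ≤ C := by
        refine Finset.sum_le_sum fun i _ => Finset.sum_le_sum fun j _ => ?_
        refine mul_le_of_le_one_right (hA0 i j) ?_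
        rw [← hx.2]
        exact Finset.single_le_sum (fun k _ => hx.1 k) (Finset.mem_univ j)
  have hcompact : IsCompact ((Set.Icc 0 C ×ˢ stdSimplex ℝ ι) ∩
      {z : ℝ × (ι → ℝ) | ∀ i, z.1 * z.2 i ≤ (A *ᵥ z.2) i}) := by
    refine (isCompact_Icc.prod (isCompact_stdSimplex ℝ ι)).inter_right ?_
    have : {z : ℝ × (ι → ℝ) | ∀ i, z.1 * z.2 i ≤ (A *ᵥ z.2) i}
        = ⋂ i, {z : ℝ × (ι → ℝ) | z.1 * z.2 i ≤ (A *ᵥ z.2) i} := by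
      ext; simp
    rw [this]
    refine isClosed_iInter fun i => isClosed_le (by fun_prop) ?_
    change Continuous fun z : ℝ × (ι → ℝ) => ∑ j, A i j * z.2 j
    fun_prop
  have hC0 : 0 ≤ C := Finset.sum_nonneg fun i _ => Finset.sum_nonneg fun j _ => hA0 i j
  have hne : ((Set.Icc 0 C ×ˢ stdSimplex ℝ ι) ∩
      {z : ℝ × (ι → ℝ) | ∀ i, z.1 * z.2 i ≤ (A *ᵥ z.2) i}).Nonempty := by
    obtain ⟨i0⟩ := ‹Nonempty ι›
    refine ⟨(0, Pi.single i0 1), ⟨⟨le_rfl, hC0⟩, single_mem_stdSimplex ℝ i0⟩, fun i => ?_⟩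
    simpa using mulVec_nonneg_of_nonneg hA0 (single_mem_stdSimplex ℝ i0).1 i
  obtain ⟨⟨r, x⟩, ⟨⟨hr, hx⟩, hrx⟩, hmax⟩ := hcompact.exists_isMaxOn hne continuous_fst.continuousOn
  have hx0 : x ≠ 0 := by
    rintro rfl
    simpa using hx.2
  have hr0 : 0 ≤ r := hr.1
  have heq : A *ᵥ x = r • x := by
    -- Otherwise the positive matrix `A ^ m` turns `A x - r x` into a strictly positive vector, so
    -- `y = A ^ m x` admits the larger value `r + ε`.
    by_contra hcon
    have hd := mulVec_pos_of_pos (x := A *ᵥ x - r • x) hpos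
      (fun i => sub_nonneg.mpr (hrx i)) (sub_ne_zero.mpr hcon)
    have hy := mulVec_pos_of_pos hpos hx.1 hx0
    set y := (A ^ m) *ᵥ x with hy_def
    have hyd : (A ^ m) *ᵥ (A *ᵥ x - r • x) = A *ᵥ y - r • y := by
      rw [mulVec_sub, mulVec_smul, mulVec_mulVec, hy_def, mulVec_mulVec, pow_mul_comm']
    rw [hyd] at hd
    obtain ⟨ε, hε, hle⟩ := exists_pos_forall_mul_le hd y
    have hs : 0 < ∑ i, y i := Finset.sum_pos (fun i _ => hy i) Finset.univ_nonempty
    have hmem : (∑ i, y i)⁻¹ • y ∈ stdSimplex ℝ ι := by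
      refine ⟨fun i => mul_nonneg (inv_nonneg.mpr hs.le) (hy i).le, ?_⟩
      simp only [Pi.smul_apply, smul_eq_mul, ← Finset.mul_sum]
      exact inv_mul_cancel₀ hs.ne'
    have hineq : ∀ i, (r + ε) * ((∑ i, y i)⁻¹ • y) i ≤ (A *ᵥ ((∑ i, y i)⁻¹ • y)) i := by
      intro i
      rw [mulVec_smul, Pi.smul_apply, Pi.smul_apply, smul_eq_mul, smul_eq_mul, mul_left_comm]
      refine mul_le_mul_of_nonneg_left ?_ (inv_nonneg.mpr hs.le)
      have := hle i
      simp only [Pi.sub_apply, Pi.smul_apply, smul_eq_mul] at this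
      linarith
    have h1 := hmax (a := (r + ε, (∑ i, y i)⁻¹ • y))
      ⟨⟨⟨by linarith, hbound _ _ hmem hineq⟩, hmem⟩, hineq⟩
    have h2 : r + ε ≤ r := h1
    linarith
  have hpw := pow_mulVec_of_eigen heq m
  have hxr : ∀ i, 0 < r ^ m * x i := fun i => by
    have := mulVec_pos_of_pos hpos hx.1 hx0 i
    rwa [hpw] at this
  refine ⟨r, x, ?_, fun i => ?_, heq⟩
  · refine lt_of_le_of_ne hr0 fun h => ?_
    have := hxr (Classical.arbitrary ι)
    rw [← h, zero_pow hm.ne'] at this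
    simp at this
  · exact pos_of_mul_pos_right (hxr i) (pow_nonneg hr0 m)

/-- Minima increase and maxima decrease. Taking `j` where the minimum is attained, `hcontr` lowers
the maximum after `m` steps by `δ` times the oscillation, so the two limits agree. The lower bound
on `c` later gives its positivity. -/
theorem tendsto_of_oscillation {ι : Type*} [Finite ι] [Nonempty ι] {u : ℕ → ι → ℝ} {m : ℕ}
    {δ : ℝ} (hδ : 0 < δ)
    (hlow : ∀ k a, (∀ i, a ≤ u k i) → ∀ i, a ≤ u (k + 1) i)
    (hup : ∀ k b, (∀ i, u k i ≤ b) → ∀ i, u (k + 1) i ≤ b)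
    (hcontr : ∀ k b j, (∀ i, u k i ≤ b) → ∀ i, u (k + m) i ≤ b - δ * (b - u k j)) :
    ∃ c, (∀ k a, (∀ i, a ≤ u k i) → a ≤ c) ∧ ∀ i, Tendsto (fun k => u k i) atTop (𝓝 c) := by
  have bdb : ∀ k, BddBelow (Set.range (u k)) := fun k => (Set.finite_range _).bddBelow
  have bda : ∀ k, BddAbove (Set.range (u k)) := fun k => (Set.finite_range _).bddAbove
  have hmono : Monotone fun k => ⨅ i, u k i :=
    monotone_nat_of_le_succ fun k => le_ciInf (hlow k _ fun i => ciInf_le (bdb k) i)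
  have hanti : Antitone fun k => ⨆ i, u k i :=
    antitone_nat_of_succ_le fun k => ciSup_le (hup k _ fun i => le_ciSup (bda k) i)
  have hle : ∀ k, ⨅ i, u k i ≤ ⨆ i, u k i := fun k =>
    (ciInf_le (bdb k) (Classical.arbitrary ι)).trans (le_ciSup (bda k) _)
  have h1 := tendsto_atTop_ciSup hmono
    ⟨⨆ i, u 0 i, by rintro _ ⟨k, rfl⟩; exact (hle k).trans (hanti (Nat.zero_le k))⟩
  have h2 := tendsto_atTop_ciInf hanti
    ⟨⨅ i, u 0 i, by rintro _ ⟨k, rfl⟩; exact (hmono (Nat.zero_le k)).trans (hle k)⟩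
  set c := ⨆ k, ⨅ i, u k i
  set c' := ⨅ k, ⨆ i, u k i
  have hstep : ∀ k, ⨆ i, u (k + m) i ≤ (⨆ i, u k i) - δ * ((⨆ i, u k i) - ⨅ i, u k i) := by
    intro k
    obtain ⟨j, hj⟩ := exists_eq_ciInf_of_finite (f := u k)
    rw [← hj]
    exact ciSup_le (hcontr k _ j fun i => le_ciSup (bda k) i)
  have hlim : c' ≤ c' - δ * (c' - c) :=
    le_of_tendsto_of_tendsto' (h2.comp (tendsto_add_atTop_nat m))
      (h2.sub ((h2.sub h1).const_mul δ)) hstep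
  have hcc : c ≤ c' := le_of_tendsto_of_tendsto' h1 h2 hle
  have hc : c' = c := by nlinarith
  rw [hc] at h2
  refine ⟨c, fun k a ha => ?_, fun i => ?_⟩
  · exact (le_ciInf ha).trans (hmono.ge_of_tendsto h1 k)
  · exact tendsto_of_tendsto_of_tendsto_of_le_of_le h1 h2 (fun k => ciInf_le (bdb k) i)
      fun k => le_ciSup (bda k) i

/-- **Perron's theorem**, convergence part: the rescaled iterates of a primitive matrix converge
to multiples of the positive eigenvector. -/
theorem IsPrimitive.tendsto_pow_mulVec [Nonempty ι] {A : Matrix ι ι ℝ} (hA : A.IsPrimitive)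
    {r : ℝ} {v : ι → ℝ} (hr : 0 < r) (hv : ∀ i, 0 < v i) (hAv : A *ᵥ v = r • v) (f : ι → ℝ) :
    ∃ c : ℝ, ((∀ i, 0 ≤ f i) → f ≠ 0 → 0 < c) ∧
      ∀ i, Tendsto (fun k : ℕ => ((A ^ k) *ᵥ f) i / r ^ k) atTop (𝓝 (c * v i)) := by
  obtain ⟨hA0, m, hm, hpos⟩ := hA
  -- Division by the eigenvector turns `A / r` into a stochastic matrix: each `u (k + l) i` is a
  -- weighted average of the `u k j`.
  set u : ℕ → ι → ℝ := fun k i => ((A ^ k) *ᵥ f) i / (r ^ k * v i) with hu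
  have hf : ∀ k i, ((A ^ k) *ᵥ f) i = r ^ k * (v i * u k i) := by
    intro k i
    have := (hv i).ne'
    simp only [hu]
    field_simp
  have hadd : ∀ l k i, u (k + l) i = ∑ j, (A ^ l) i j * v j / (r ^ l * v i) * u k j := by
    intro l k i
    have := (hv i).ne'
    have h1 : ((A ^ (k + l)) *ᵥ f) i = ∑ j, (A ^ l) i j * (r ^ k * (v j * u k j)) := by
      rw [add_comm, pow_add, ← mulVec_mulVec]
      exact Finset.sum_congr rfl fun j _ => by rw [hf k j]
    change ((A ^ (k + l)) *ᵥ f) i / _ = _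
    rw [h1, Finset.sum_div]
    refine Finset.sum_congr rfl fun j _ => ?_
    rw [pow_add]
    field_simp
  have hsum : ∀ l i, ∑ j, (A ^ l) i j * v j / (r ^ l * v i) = 1 := by
    intro l i
    have h1 : ∑ j, (A ^ l) i j * v j = r ^ l * v i := congrFun (pow_mulVec_of_eigen hAv l) i
    rw [← Finset.sum_div, h1, div_self (mul_pos (pow_pos hr l) (hv i)).ne']
  have hP : ∀ i j, 0 ≤ (A ^ 1) i j * v j / (r ^ 1 * v i) := fun i j => by
    rw [pow_one, pow_one]
    exact div_nonneg (mul_nonneg (hA0 i j) (hv j).le) (mul_pos hr (hv i)).le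
  -- `δ` bounds all entries of the `m`-step stochastic matrix from below; this is the contraction
  -- constant.
  obtain ⟨δ, hδ, hδle⟩ := exists_pos_forall_mul_le
    (a := fun z : ι × ι => (A ^ m) z.1 z.2 * v z.2 / (r ^ m * v z.1))
    (fun z => div_pos (mul_pos (hpos _ _) (hv _)) (mul_pos (pow_pos hr m) (hv _))) (fun _ => 1)
  simp only [mul_one, Prod.forall] at hδle
  obtain ⟨c, hc, hlim⟩ := tendsto_of_oscillation (u := u) (m := m) hδ
    (fun k a ha i => by
      rw [hadd 1 k i, ← mul_one a, ← hsum 1 i, Finset.mul_sum]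
      refine Finset.sum_le_sum fun j _ => ?_
      rw [mul_comm]
      exact mul_le_mul_of_nonneg_left (ha j) (hP i j))
    (fun k b hb i => by
      rw [hadd 1 k i, ← mul_one b, ← hsum 1 i, Finset.mul_sum]
      refine Finset.sum_le_sum fun j _ => ?_
      rw [mul_comm b]
      exact mul_le_mul_of_nonneg_left (hb j) (hP i j))
    (fun k b j hb i => by
      have h1 : b - u (k + m) i
          = ∑ j, (A ^ m) i j * v j / (r ^ m * v i) * (b - u k j) := by
        simp only [mul_sub, Finset.sum_sub_distrib, ← Finset.sum_mul, hsum, one_mul]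
        rw [← hadd]
      have h2 : δ * (b - u k j) ≤ b - u (k + m) i := by
        rw [h1]
        calc δ * (b - u k j) ≤ (A ^ m) i j * v j / (r ^ m * v i) * (b - u k j) :=
              mul_le_mul_of_nonneg_right (hδle i j) (sub_nonneg.mpr (hb j))
          _ ≤ _ := Finset.single_le_sum
              (f := fun j => (A ^ m) i j * v j / (r ^ m * v i) * (b - u k j))
              (fun j _ => mul_nonneg (hδ.le.trans (hδle i j)) (sub_nonneg.mpr (hb j)))
              (Finset.mem_univ j)
      linarith)
  refine ⟨c, fun hf0 hfne => ?_, fun i => ?_⟩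
  · have hum : ∀ i, 0 < u m i := fun i =>
      div_pos (mulVec_pos_of_pos hpos hf0 hfne i) (mul_pos (pow_pos hr m) (hv i))
    obtain ⟨ε, hε, hle⟩ := exists_pos_forall_mul_le hum (fun _ => 1)
    exact hε.trans_le (hc m ε fun i => by simpa using hle i)
  · refine ((hlim i).mul_const (v i)).congr fun k => ?_
    have := (hv i).ne'
    have := (pow_pos hr k).ne'
    simp only [hu]
    field_simp

/-- The eigenvalue of a positive eigenvector of a nonnegative matrix is its spectral radius. -/
theorem specRadius_eq_of_pos_eigenvector {n : ℕ} [Nonempty (Fin n)] {A : Matrix (Fin n) (Fin n) ℝ}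
    (hA : ∀ i j, 0 ≤ A i j) {r : ℝ} {v : Fin n → ℝ} (hr : 0 < r) (hv : ∀ i, 0 < v i)
    (hAv : A *ᵥ v = r • v) : A.specRadius = r := by
  have hspec : ∀ z : ℂ, z ∈ spectrum ℂ (A.map (algebraMap ℝ ℂ)) ↔
      ∃ w : Fin n → ℂ, w ≠ 0 ∧ (A.map (algebraMap ℝ ℂ)) *ᵥ w = z • w := by
    intro z
    rw [← Matrix.spectrum_toLin', ← Module.End.hasEigenvalue_iff_mem_spectrum]
    constructor
    · intro h
      obtain ⟨w, hw⟩ := h.exists_hasEigenvector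
      exact ⟨w, hw.2, by simpa using hw.apply_eq_smul⟩
    · rintro ⟨w, hw0, hw⟩
      exact Module.End.hasEigenvalue_of_hasEigenvector (x := w)
        ⟨Module.End.mem_eigenspace_iff.mpr (by simpa using hw), hw0⟩
  have hle : ∀ z ∈ spectrum ℂ (A.map (algebraMap ℝ ℂ)), ‖z‖ ≤ r := by
    intro z hz
    obtain ⟨w, hw0, hw⟩ := (hspec z).mp hz
    -- At the index where `w` is largest relative to `v`, the triangle inequality in the eigenvalue
    -- equation gives `‖z‖ ≤ r`.
    obtain ⟨i, hi⟩ := Finite.exists_max fun i => ‖w i‖ / v i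
    set s := ‖w i‖ / v i with hs
    have hws : ∀ j, ‖w j‖ ≤ s * v j := fun j => (div_le_iff₀ (hv j)).mp (hi j)
    have hs0 : 0 < s := by
      obtain ⟨j, hj⟩ := Function.ne_iff.mp hw0
      exact (div_pos (norm_pos_iff.mpr hj) (hv j)).trans_le (hi j)
    have hwi : ‖w i‖ = s * v i := by rw [hs, div_mul_cancel₀ _ (hv i).ne']
    have h1 : ‖z‖ * (s * v i) ≤ s * (r * v i) := by
      calc ‖z‖ * (s * v i) = ‖(z • w) i‖ := by rw [← hwi, Pi.smul_apply, smul_eq_mul, norm_mul]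
        _ = ‖∑ j, (A i j : ℂ) * w j‖ := by rw [← hw]; rfl
        _ ≤ ∑ j, ‖(A i j : ℂ) * w j‖ := norm_sum_le _ _
        _ ≤ ∑ j, s * (A i j * v j) := by
          refine Finset.sum_le_sum fun j _ => ?_
          rw [norm_mul, Complex.norm_real, Real.norm_of_nonneg (hA i j), mul_left_comm]
          exact mul_le_mul_of_nonneg_left (hws j) (hA i j)
        _ = s * (A *ᵥ v) i := by rw [← Finset.mul_sum]; rfl
        _ = s * (r * v i) := by rw [hAv]; rfl
    have h2 : 0 < s * v i := mul_pos hs0 (hv i)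
    nlinarith
  have hmem : (r : ℂ) ∈ spectrum ℂ (A.map (algebraMap ℝ ℂ)) := by
    refine (hspec _).mpr ⟨fun i => (v i : ℂ), ?_, ?_⟩
    · intro h
      have := congrFun h (Classical.arbitrary _)
      exact (hv _).ne' (by simpa using this)
    · ext i
      have h := congrFun hAv i
      change ∑ j, (A i j : ℂ) * (v j : ℂ) = (r : ℂ) * (v i : ℂ)
      have h' : ∑ j, A i j * v j = r * v i := h
      exact_mod_cast h'
  have : spectralRadius ℂ (A.map (algebraMap ℝ ℂ)) = ENNReal.ofReal r := by
    refine le_antisymm (iSup₂_le fun z hz => ?_) ?_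
    · rw [← enorm_eq_nnnorm, ← ofReal_norm]
      exact ENNReal.ofReal_le_ofReal (hle z hz)
    · refine le_trans (le_of_eq ?_) (le_iSup₂ (f := fun z (_ : z ∈ spectrum ℂ
        (A.map (algebraMap ℝ ℂ))) => (‖z‖₊ : ENNReal)) (r : ℂ) hmem)
      rw [← enorm_eq_nnnorm, ← ofReal_norm, Complex.norm_real, Real.norm_of_nonneg hr.le]
  rw [specRadius, this, ENNReal.toReal_ofReal hr.le]

end Matrix

/-! ### Weights of networks and their behavior under substitution. -/

namespace ColoredNetwork

variable {n : ℕ}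

noncomputable instance (G : ColoredNetwork n) : Fintype G.E := Fintype.ofFinite _

/-- The total weight of the arcs of `G`, where an arc of color `j` has weight `f j`. -/
noncomputable def weight (G : ColoredNetwork n) (f : Fin n → ℝ) : ℝ := ∑ e : G.E, f (G.col e)

theorem weight_one (G : ColoredNetwork n) : G.weight (fun _ => 1) = G.numArcs := by
  simp [weight, numArcs, Nat.card_eq_fintype_card]

theorem weight_mono (G : ColoredNetwork n) {f g : Fin n → ℝ} (h : ∀ i, f i ≤ g i) :
    G.weight f ≤ G.weight g :=
  Finset.sum_le_sum fun e _ => h (G.col e)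

theorem weight_nonneg (G : ColoredNetwork n) {f : Fin n → ℝ} (h : ∀ i, 0 ≤ f i) :
    0 ≤ G.weight f :=
  Finset.sum_nonneg fun e _ => h (G.col e)

theorem weight_smul (G : ColoredNetwork n) (c : ℝ) (f : Fin n → ℝ) :
    G.weight (c • f) = c * G.weight f := by
  simp [weight, Finset.mul_sum]

theorem weight_eq_sum_chi (G : ColoredNetwork n) (f : Fin n → ℝ) :
    G.weight f = ∑ j, (G.chi j : ℝ) * f j := by
  classical
  rw [weight, ← Finset.sum_fiberwise Finset.univ G.col]
  refine Finset.sum_congr rfl fun j _ => ?_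
  rw [chi, Nat.card_eq_fintype_card, Fintype.card_subtype,
    Finset.sum_congr rfl (g := fun _ => f j) fun e he => by rw [(Finset.mem_filter.mp he).2],
    Finset.sum_const, nsmul_eq_mul]

theorem weight_subst (G : ColoredNetwork n) (R : G.E → ReplacementNetwork n) (f : Fin n → ℝ) :
    (G.subst R).weight f = ∑ e, (R e).weight f := by
  have h : (G.subst R).weight f = ∑ x : Σ e : G.E, (R e).E, f ((R x.1).col x.2) :=
    -- The two arc types agree by definition but carry different `Fintype` instances.
    @Fintype.sum_equiv (G.subst R).E (Σ e : G.E, (R e).E) ℝ _ _ _ (Equiv.refl _) _ _ fun _ => rfl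
  rw [h, Fintype.sum_sigma]
  rfl

end ColoredNetwork

/-! ### Functions of finitely many independent choices. -/

namespace SubstitutionSystem

variable {n : ℕ} (S : SubstitutionSystem n)

instance : IsProbabilityMeasure S.law := by
  unfold law
  infer_instance

theorem finite_site_length_eq (t : ℕ) : {s : S.Label × Fin n | s.1.2.length = t}.Finite := by
  have h := ((Set.finite_univ (α := S.G0.E)).prod
    (List.finite_length_eq (Σ i : Fin n, Σ k : Fin (S.q i), (S.R i k).E) t)).prod
    (Set.finite_univ (α := Fin n))
  exact h.subset fun s hs => ⟨⟨trivial, hs⟩, trivial⟩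

theorem finite_site_length_lt (t : ℕ) : {s : S.Label × Fin n | s.1.2.length < t}.Finite := by
  have h := (Set.finite_lt_nat t).biUnion fun i _ => S.finite_site_length_eq i
  exact h.subset fun s hs => by simpa using hs

/-- The finitely many sites at which choices for the `t`-th network may have to be made. -/
noncomputable def level (t : ℕ) : Finset (S.Label × Fin n) := (S.finite_site_length_eq t).toFinset

@[simp] theorem mem_level {t : ℕ} {s : S.Label × Fin n} : s ∈ S.level t ↔ s.1.2.length = t := by
  simp [level]

/-- `f` depends only on the choices that are made before the `t`-th network. -/
def Past {β : Type*} (t : ℕ) (f : S.Sample → β) : Prop :=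
  DependsOn f {s : S.Label × Fin n | s.1.2.length < t}

variable {S}

/-- Finitely many choices, each with finitely many values, so `f` factors through a finite discrete
space. -/
theorem measurable_of_dependsOn {f : S.Sample → ℝ} {T : Set (S.Label × Fin n)} (hT : T.Finite)
    (hf : DependsOn f T) : Measurable f := by
  have := hT.to_subtype
  obtain ⟨g, rfl⟩ := dependsOn_iff_exists_comp.mp hf
  refine Measurable.comp (g := g) (measurable_of_countable g) ?_
  exact measurable_pi_lambda _ fun i => measurable_pi_apply _

theorem integrable_of_dependsOn {f : S.Sample → ℝ} {T : Set (S.Label × Fin n)} (hT : T.Finite)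
    (hf : DependsOn f T) : Integrable f S.law := by
  have hm := measurable_of_dependsOn hT hf
  have := hT.to_subtype
  obtain ⟨g, rfl⟩ := dependsOn_iff_exists_comp.mp hf
  obtain ⟨C, hC⟩ := (Set.finite_range fun x => ‖g x‖).bddAbove
  exact Integrable.of_bound hm.aestronglyMeasurable C
    (Eventually.of_forall fun ω => hC ⟨_, rfl⟩)

theorem integral_eval (s : S.Label × Fin n) (h : Fin (S.q s.2) → ℝ) :
    ∫ ω, h (ω s) ∂S.law = ∑ k, (S.p s.2 k).toReal * h k := by
  have h1 : ∫ ω, h (ω s) ∂S.law = ∫ k, h k ∂(S.p s.2).toMeasure := by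
    rw [← Measure.infinitePi_map_eval (fun s : S.Label × Fin n => (S.p s.2).toMeasure) s]
    exact (integral_map (measurable_pi_apply s).aemeasurable
      (measurable_of_countable h).aestronglyMeasurable).symm
  rw [h1, PMF.integral_eq_sum]
  rfl

/-- The choice at a site outside `T` is independent of `φ`. This takes the place of conditional
expectation. -/
theorem integral_mul_eval {φ : S.Sample → ℝ} {T : Set (S.Label × Fin n)} (hT : T.Finite)
    (hφ : DependsOn φ T) {s : S.Label × Fin n} (hs : s ∉ T) (h : Fin (S.q s.2) → ℝ) :
    ∫ ω, φ ω * h (ω s) ∂S.law = (∫ ω, φ ω ∂S.law) * ∑ k, (S.p s.2 k).toReal * h k := by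
  classical
  have hind : ProbabilityTheory.iIndepFun (fun (s : S.Label × Fin n) (ω : S.Sample) => ω s)
      S.law :=
    ProbabilityTheory.iIndepFun_infinitePi (P := fun s : S.Label × Fin n => (S.p s.2).toMeasure)
      (X := fun _ x => x) fun _ => measurable_id
  have hφ' : DependsOn φ (hT.toFinset : Set (S.Label × Fin n)) := by simpa using hφ
  obtain ⟨g, rfl⟩ := dependsOn_iff_exists_comp.mp hφ'
  have h2 := hind.indepFun_finset hT.toFinset {s} (by simpa using hs)
    fun s => measurable_pi_apply s
  have h3 := h2.comp (φ := g) (ψ := fun x => h (x ⟨s, by simp⟩))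
    (measurable_of_countable _) (measurable_of_countable _)
  rw [← integral_eval]
  exact h3.integral_fun_mul_eq_mul_integral
    (measurable_of_dependsOn (Finset.finite_toSet _) hφ').aestronglyMeasurable
    ((measurable_of_countable h).comp (measurable_pi_apply s)).aestronglyMeasurable

namespace Past

variable {t : ℕ}

theorem mono {β : Type*} {t' : ℕ} (h : t ≤ t') {f : S.Sample → β} (hf : S.Past t f) :
    S.Past t' f :=
  DependsOn.mono (fun _ hs => lt_of_lt_of_le hs h) hf

theorem comp {β γ : Type*} {f : S.Sample → β} (hf : S.Past t f) (g : β → γ) :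
    S.Past t fun ω => g (f ω) :=
  fun _ _ h => congrArg g (hf h)

theorem comp₂ {β β' γ : Type*} {f : S.Sample → β} {f' : S.Sample → β'} (hf : S.Past t f)
    (hf' : S.Past t f') (g : β → β' → γ) : S.Past t fun ω => g (f ω) (f' ω) :=
  fun _ _ h => congrArg₂ g (hf h) (hf' h)

theorem mul {f g : S.Sample → ℝ} (hf : S.Past t f) (hg : S.Past t g) :
    S.Past t fun ω => f ω * g ω :=
  hf.comp₂ hg (· * ·)

theorem sub {f g : S.Sample → ℝ} (hf : S.Past t f) (hg : S.Past t g) :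
    S.Past t fun ω => f ω - g ω :=
  hf.comp₂ hg (· - ·)

theorem measurable {f : S.Sample → ℝ} (hf : S.Past t f) : Measurable f :=
  measurable_of_dependsOn (S.finite_site_length_lt t) hf

theorem integrable {f : S.Sample → ℝ} (hf : S.Past t f) : Integrable f S.law :=
  integrable_of_dependsOn (S.finite_site_length_lt t) hf

end Past

/-! ### Conditional mean and variance of one step. -/

variable (S)

theorem past_namedNetwork (t : ℕ) : S.Past t fun ω => S.namedNetwork ω t := by
  induction t with
  | zero => exact fun _ _ _ => rfl
  | succ t ih =>
    intro ω ω' h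
    have h1 : S.namedNetwork ω t = S.namedNetwork ω' t :=
      ih fun s hs => h s (lt_trans hs (Nat.lt_succ_self t))
    change (S.namedNetwork ω t).step ω = (S.namedNetwork ω' t).step ω'
    rw [← h1]
    have h2 : (S.namedNetwork ω t).choice ω = (S.namedNetwork ω t).choice ω' := by
      funext e
      exact h (_, _) (by
        change ((S.namedNetwork ω t).name e).2.length < t + 1
        rw [S.name_length]
        exact Nat.lt_succ_self t)
    unfold NamedNetwork.step
    rw [h2]

/-- The total weight of the arcs of the `t`-th network. -/
noncomputable def wt (f : Fin n → ℝ) (t : ℕ) (ω : S.Sample) : ℝ := (S.realisation ω t).weight f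

theorem past_wt (f : Fin n → ℝ) (t : ℕ) : S.Past t (S.wt f t) :=
  (S.past_namedNetwork t).comp fun N => N.net.weight f

open Classical in
/-- The indicator of the event that the `t`-th network has an arc with the name and the color
that `s` consists of. -/
noncomputable def alive (t : ℕ) (s : S.Label × Fin n) (ω : S.Sample) : ℝ :=
  if ∃ e, ((S.namedNetwork ω t).name e, (S.namedNetwork ω t).net.col e) = s then 1 else 0

theorem past_alive (t : ℕ) (s : S.Label × Fin n) : S.Past t (S.alive t s) := by
  classical
  exact (S.past_namedNetwork t).comp fun N =>
    if ∃ e, (N.name e, N.net.col e) = s then (1 : ℝ) else 0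

theorem alive_nonneg (t : ℕ) (s : S.Label × Fin n) (ω : S.Sample) : 0 ≤ S.alive t s ω := by
  unfold alive
  split_ifs <;> norm_num

theorem alive_mul_self (t : ℕ) (s : S.Label × Fin n) (ω : S.Sample) :
    S.alive t s ω * S.alive t s ω = S.alive t s ω := by
  unfold alive
  split_ifs <;> norm_num

/-- Names are injective, so a sum over the random arc set becomes a sum over a fixed finite set with
indicator coefficients, which can be exchanged with integration. -/
theorem sum_arcs_eq (t : ℕ) (ω : S.Sample) (F : S.Label × Fin n → ℝ) :
    ∑ e, F ((S.namedNetwork ω t).name e, (S.namedNetwork ω t).net.col e)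
      = ∑ s ∈ S.level t, S.alive t s ω * F s := by
  classical
  have hinj : Function.Injective fun e =>
      ((S.namedNetwork ω t).name e, (S.namedNetwork ω t).net.col e) :=
    fun e e' h => S.name_injective ω t (Prod.mk.inj h).1
  rw [← Finset.sum_image (g := fun e =>
    ((S.namedNetwork ω t).name e, (S.namedNetwork ω t).net.col e)) (f := F) hinj.injOn]
  simp only [alive, ite_mul, one_mul, zero_mul]
  rw [← Finset.sum_filter]
  refine Finset.sum_congr ?_ fun _ _ => rfl
  ext s
  simp only [Finset.mem_image, Finset.mem_univ, true_and, Finset.mem_filter, mem_level]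
  refine ⟨?_, fun h => h.2⟩
  rintro ⟨e, rfl⟩
  exact ⟨S.name_length ω t e, e, rfl⟩

theorem wt_eq_sum (f : Fin n → ℝ) (t : ℕ) (ω : S.Sample) :
    S.wt f t ω = ∑ s ∈ S.level t, S.alive t s ω * f s.2 :=
  S.sum_arcs_eq t ω fun s => f s.2

theorem wt_succ (f : Fin n → ℝ) (t : ℕ) (ω : S.Sample) :
    S.wt f (t + 1) ω = ∑ s ∈ S.level t, S.alive t s ω * (S.R s.2 (ω s)).weight f :=
  (ColoredNetwork.weight_subst _ _ f).trans
    (S.sum_arcs_eq t ω fun s => (S.R s.2 (ω s)).weight f)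

theorem sum_prob (i : Fin n) : ∑ k, (S.p i k).toReal = 1 := by
  have := (S.p i).tsum_coe
  rw [tsum_fintype] at this
  rw [← ENNReal.toReal_sum fun k _ => (S.p i).apply_ne_top k, this, ENNReal.toReal_one]

theorem sum_prob_mul_weight (f : Fin n → ℝ) (i : Fin n) :
    ∑ k, (S.p i k).toReal * (S.R i k).weight f = (S.arcMatrix.mulVec f) i := by
  simp only [ColoredNetwork.weight_eq_sum_chi, Matrix.mulVec, dotProduct, arcMatrix, Matrix.of_apply,
    Finset.mul_sum, Finset.sum_mul]
  rw [Finset.sum_comm]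
  simp only [mul_assoc]

/-- The deviation of the weight of the next network from its conditional expectation. -/
noncomputable def inc (f : Fin n → ℝ) (t : ℕ) (ω : S.Sample) : ℝ :=
  S.wt f (t + 1) ω - S.wt (S.arcMatrix.mulVec f) t ω

theorem past_inc (f : Fin n → ℝ) (t : ℕ) : S.Past (t + 1) (S.inc f t) :=
  (S.past_wt f (t + 1)).sub ((S.past_wt _ t).mono (Nat.le_succ t))

/-- The deviation of the weight of the `k`-th replacement for color `i` from its mean. -/
noncomputable def dev (f : Fin n → ℝ) (i : Fin n) (k : Fin (S.q i)) : ℝ :=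
  (S.R i k).weight f - (S.arcMatrix.mulVec f) i

theorem sum_prob_mul_dev (f : Fin n → ℝ) (i : Fin n) :
    ∑ k, (S.p i k).toReal * S.dev f i k = 0 := by
  simp only [dev, mul_sub, Finset.sum_sub_distrib, ← Finset.sum_mul, sum_prob,
    sum_prob_mul_weight, one_mul, sub_self]

theorem inc_eq_sum (f : Fin n → ℝ) (t : ℕ) (ω : S.Sample) :
    S.inc f t ω = ∑ s ∈ S.level t, S.alive t s ω * S.dev f s.2 (ω s) := by
  rw [inc, wt_succ, wt_eq_sum, ← Finset.sum_sub_distrib]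
  exact Finset.sum_congr rfl fun s _ => (mul_sub _ _ _).symm

variable {S}

theorem notMem_past_of_mem_level {t : ℕ} {s : S.Label × Fin n} (hs : s ∈ S.level t) :
    s ∉ {s : S.Label × Fin n | s.1.2.length < t} := by
  simpa using (S.mem_level.mp hs).ge

theorem Past.mul_eval_dependsOn {t : ℕ} {φ : S.Sample → ℝ} (hφ : S.Past t φ)
    (s : S.Label × Fin n) (h : Fin (S.q s.2) → ℝ) :
    DependsOn (fun ω => φ ω * h (ω s)) (insert s {s : S.Label × Fin n | s.1.2.length < t}) := by
  intro ω ω' hω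
  change φ ω * h (ω s) = φ ω' * h (ω' s)
  rw [hω s (Set.mem_insert _ _), hφ fun s' hs' => hω s' (Set.mem_insert_of_mem _ hs')]

theorem Past.integrable_mul_eval {t : ℕ} {φ : S.Sample → ℝ} (hφ : S.Past t φ)
    (s : S.Label × Fin n) (h : Fin (S.q s.2) → ℝ) :
    Integrable (fun ω => φ ω * h (ω s)) S.law :=
  integrable_of_dependsOn ((S.finite_site_length_lt t).insert s) (hφ.mul_eval_dependsOn s h)

/-- The martingale difference property: which arcs are alive is decided by the past, while their
choices are fresh and have centered deviations. -/
theorem integral_mul_inc {t : ℕ} {φ : S.Sample → ℝ} (hφ : S.Past t φ) (f : Fin n → ℝ) :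
    ∫ ω, φ ω * S.inc f t ω ∂S.law = 0 := by
  have h : ∀ s, S.Past t fun ω => φ ω * S.alive t s ω := fun s => hφ.mul (S.past_alive t s)
  simp only [inc_eq_sum, Finset.mul_sum, ← mul_assoc]
  rw [integral_finsetSum _ fun s _ => (h s).integrable_mul_eval s _]
  refine Finset.sum_eq_zero fun s hs => ?_
  rw [integral_mul_eval (S.finite_site_length_lt t) (h s) (notMem_past_of_mem_level hs),
    sum_prob_mul_dev, mul_zero]

theorem integral_mul_wt_succ {t : ℕ} {φ : S.Sample → ℝ} (hφ : S.Past t φ) (f : Fin n → ℝ) :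
    ∫ ω, φ ω * S.wt f (t + 1) ω ∂S.law = ∫ ω, φ ω * S.wt (S.arcMatrix.mulVec f) t ω ∂S.law := by
  have h := integral_mul_inc hφ f
  simp only [inc, mul_sub] at h
  rw [integral_sub ((hφ.mono (Nat.le_succ t)).mul (S.past_wt f (t + 1))).integrable
    (hφ.mul (S.past_wt _ t)).integrable] at h
  linarith

theorem integral_mul_dev_mul_dev {t : ℕ} {φ : S.Sample → ℝ} (hφ : S.Past t φ) (f : Fin n → ℝ)
    {s s' : S.Label × Fin n} (hs' : s' ∈ S.level t) (hne : s' ≠ s) :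
    ∫ ω, φ ω * S.dev f s.2 (ω s) * S.dev f s'.2 (ω s') ∂S.law = 0 := by
  rw [integral_mul_eval ((S.finite_site_length_lt t).insert s) (hφ.mul_eval_dependsOn s _),
    sum_prob_mul_dev, mul_zero]
  rintro (h | h)
  · exact hne h
  · exact notMem_past_of_mem_level hs' h

-- Distinct arcs make independent centered choices, so the cross terms vanish. Each living arc
-- contributes the variance for its color, and `C` is the sum of these variances.
variable (S) in
theorem exists_integral_mul_inc_sq_le (f : Fin n → ℝ) : ∃ C : ℝ, 0 ≤ C ∧
    ∀ (t : ℕ) (φ : S.Sample → ℝ), S.Past t φ → (∀ ω, 0 ≤ φ ω) →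
      ∫ ω, φ ω * S.inc f t ω ^ 2 ∂S.law ≤ C * ∫ ω, φ ω * S.wt (fun _ => 1) t ω ∂S.law := by
  classical
  set c : Fin n → ℝ := fun i => ∑ k, (S.p i k).toReal * (S.dev f i k * S.dev f i k) with hc
  have hc0 : ∀ i, 0 ≤ c i := fun i => Finset.sum_nonneg fun k _ =>
    mul_nonneg ENNReal.toReal_nonneg (mul_self_nonneg _)
  refine ⟨∑ i, c i, Finset.sum_nonneg fun i _ => hc0 i, fun t φ hφ hφ0 => ?_⟩
  have h : ∀ s, S.Past t fun ω => φ ω * S.alive t s ω := fun s => hφ.mul (S.past_alive t s)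
  have h' : ∀ s s', S.Past t fun ω => φ ω * S.alive t s ω * S.alive t s' ω :=
    fun s s' => (h s).mul (S.past_alive t s')
  have hexp : ∀ ω, φ ω * S.inc f t ω ^ 2 = ∑ s ∈ S.level t, ∑ s' ∈ S.level t,
      φ ω * S.alive t s ω * S.alive t s' ω * S.dev f s.2 (ω s) * S.dev f s'.2 (ω s') := by
    intro ω
    rw [inc_eq_sum, sq, Finset.sum_mul_sum, Finset.mul_sum]
    refine Finset.sum_congr rfl fun s _ => ?_
    rw [Finset.mul_sum]
    exact Finset.sum_congr rfl fun s' _ => by ring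
  have hint : ∀ s s', Integrable (fun ω => φ ω * S.alive t s ω * S.alive t s' ω *
      S.dev f s.2 (ω s) * S.dev f s'.2 (ω s')) S.law := by
    intro s s'
    refine integrable_of_dependsOn (((S.finite_site_length_lt t).insert s).insert s') ?_
    intro ω ω' hω
    have h1 := ((h' s s').mul_eval_dependsOn s (S.dev f s.2))
      fun x hx => hω x (Set.mem_insert_of_mem _ hx)
    beta_reduce at h1 ⊢
    rw [hω s' (Set.mem_insert _ _), h1]
  have hdiag : ∀ s ∈ S.level t, ∑ s' ∈ S.level t, ∫ ω, φ ω * S.alive t s ω * S.alive t s' ω *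
      S.dev f s.2 (ω s) * S.dev f s'.2 (ω s') ∂S.law
      = (∫ ω, φ ω * S.alive t s ω ∂S.law) * c s.2 := by
    intro s hs
    rw [Finset.sum_eq_single_of_mem s hs
      fun s' hs' hne => integral_mul_dev_mul_dev (h' s s') f hs' hne]
    simp only [mul_assoc _ (S.alive t s _) (S.alive t s _), alive_mul_self]
    simp only [mul_assoc _ (S.dev f s.2 _) (S.dev f s.2 _)]
    exact integral_mul_eval (S.finite_site_length_lt t) (h s) (notMem_past_of_mem_level hs)
      fun k => S.dev f s.2 k * S.dev f s.2 k
  simp only [hexp, wt_eq_sum, mul_one, Finset.mul_sum]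
  rw [integral_finsetSum _ fun s _ => integrable_finsetSum _ fun s' _ => hint s s',
    integral_finsetSum _ fun s _ => (h s).integrable, Finset.mul_sum]
  refine Finset.sum_le_sum fun s hs => ?_
  rw [integral_finsetSum _ fun s' _ => hint s s', hdiag s hs, mul_comm]
  exact mul_le_mul_of_nonneg_right
    (Finset.single_le_sum (fun i _ => hc0 i) (Finset.mem_univ s.2))
    (integral_nonneg fun ω => mul_nonneg (hφ0 ω) (S.alive_nonneg t s ω))

end SubstitutionSystem

/-! ### Perron eigenvalues of matrices with row sums at least one. -/

namespace Matrix

variable {ι : Type*} [Fintype ι] [Nonempty ι]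

theorem one_le_of_pos_eigenvector {A : Matrix ι ι ℝ} (hA : ∀ i j, 0 ≤ A i j)
    (hone : ∀ i, 1 ≤ (A *ᵥ fun _ => 1) i) {r : ℝ} {v : ι → ℝ} (hv : ∀ i, 0 < v i)
    (hAv : A *ᵥ v = r • v) : 1 ≤ r := by
  obtain ⟨i, hi⟩ := Finite.exists_min v
  have h1 : v i * (A *ᵥ fun _ => 1) i ≤ r * v i := by
    calc v i * (A *ᵥ fun _ => 1) i = ∑ j, A i j * v i := by
          simp only [mulVec, dotProduct, Finset.mul_sum, mul_one, mul_comm]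
      _ ≤ ∑ j, A i j * v j :=
          Finset.sum_le_sum fun j _ => mul_le_mul_of_nonneg_left (hi j) (hA i j)
      _ = r * v i := congrFun hAv i
  have h2 := hone i
  have h3 := hv i
  nlinarith

variable [DecidableEq ι]

/-- If `g = A 1 - 1 ≥ 0` were nonzero, `A ^ k g` would tend to a positive multiple of `v`. But it is
the difference of consecutive terms of the convergent sequence `A ^ k 1`. -/
theorem IsPrimitive.mulVec_one_eq_one {A : Matrix ι ι ℝ} (hA : A.IsPrimitive)
    (hone : ∀ i, 1 ≤ (A *ᵥ fun _ => 1) i) {v : ι → ℝ} (hv : ∀ i, 0 < v i) (hAv : A *ᵥ v = v) :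
    A *ᵥ (fun _ => 1) = fun _ => 1 := by
  by_contra hne
  have hAv' : A *ᵥ v = (1 : ℝ) • v := by rw [hAv, one_smul]
  obtain ⟨c, hc, hlim⟩ := hA.tendsto_pow_mulVec one_pos hv hAv' (A *ᵥ (fun _ => 1) - fun _ => 1)
  have hc0 := hc (fun i => sub_nonneg.mpr (hone i)) (sub_ne_zero.mpr hne)
  obtain ⟨c', -, hlim'⟩ := hA.tendsto_pow_mulVec one_pos hv hAv' (fun _ => 1)
  have i := Classical.arbitrary ι
  have h1 := ((hlim' i).comp (tendsto_add_atTop_nat 1)).sub (hlim' i)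
  rw [sub_self] at h1
  have h2 := tendsto_nhds_unique (hlim i) (h1.congr fun k => by
    simp only [Function.comp, one_pow, div_one, mulVec_sub, mulVec_mulVec, pow_succ, Pi.sub_apply,
      mul_one])
  exact (mul_pos hc0 (hv i)).ne' h2

end Matrix

/-- A sequence of functions whose integrals of absolute values are summable is summable almost
everywhere. -/
theorem ae_summable_norm_of_summable_integral_norm {α : Type*} [MeasurableSpace α] {μ : Measure α}
    {F : ℕ → α → ℝ} (hF : ∀ t, Integrable (F t) μ) (hs : Summable fun t => ∫ x, ‖F t x‖ ∂μ) :
    ∀ᵐ x ∂μ, Summable fun t => ‖F t x‖ := by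
  have hm : ∀ t, AEMeasurable (fun x => ‖F t x‖ₑ) μ := fun t =>
    (hF t).aestronglyMeasurable.enorm
  have h1 : ∫⁻ x, ∑' t, ‖F t x‖ₑ ∂μ ≠ ⊤ := by
    rw [lintegral_tsum hm]
    simp only [← ofReal_integral_norm_eq_lintegral_enorm (hF _)]
    rw [← ENNReal.ofReal_tsum_of_nonneg (fun t => integral_nonneg fun x => norm_nonneg _) hs]
    exact ENNReal.ofReal_ne_top
  filter_upwards [ae_lt_top' (AEMeasurable.tsum hm) h1] with x hx
  exact (ENNReal.summable_toReal hx.ne).congr fun t => toReal_enorm _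

/-! ### Almost sure convergence of the rescaled weights. -/

namespace SubstitutionSystem

variable {n : ℕ} (S : SubstitutionSystem n)

theorem wt_mono {f g : Fin n → ℝ} (h : ∀ i, f i ≤ g i) (t : ℕ) (ω : S.Sample) :
    S.wt f t ω ≤ S.wt g t ω :=
  ColoredNetwork.weight_mono _ h

theorem wt_nonneg {f : Fin n → ℝ} (h : ∀ i, 0 ≤ f i) (t : ℕ) (ω : S.Sample) :
    0 ≤ S.wt f t ω :=
  ColoredNetwork.weight_nonneg _ h

theorem wt_smul (c : ℝ) (f : Fin n → ℝ) (t : ℕ) (ω : S.Sample) :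
    S.wt (c • f) t ω = c * S.wt f t ω :=
  ColoredNetwork.weight_smul _ c f

theorem wt_eq_sum_chi (f : Fin n → ℝ) (t : ℕ) (ω : S.Sample) :
    S.wt f t ω = ∑ j, ((S.realisation ω t).chi j : ℝ) * f j :=
  ColoredNetwork.weight_eq_sum_chi _ f

/-- Linearity reduces all `f` to finitely many indicators, so a single null set serves every `f`,
including the varying `M ^ k f`. -/
theorem inc_eq_sum_single (f : Fin n → ℝ) (t : ℕ) (ω : S.Sample) :
    S.inc f t ω = ∑ j, f j * S.inc (fun i => if j = i then 1 else 0) t ω := by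
  have h := LinearMap.pi_apply_eq_sum_univ (R := ℝ) (M₂ := ℝ)
    { toFun := fun f => S.inc f t ω
      map_add' := fun f g => by
        simp only [inc, wt_eq_sum_chi, Matrix.mulVec_add, Pi.add_apply, mul_add,
          Finset.sum_add_distrib]
        ring
      map_smul' := fun c f => by
        simp only [inc, Matrix.mulVec_smul, wt_smul, RingHom.id_apply, smul_eq_mul]
        ring } f
  exact h

theorem wt_eq_add_sum_inc (t : ℕ) (f : Fin n → ℝ) (ω : S.Sample) :
    S.wt f t ω = S.wt ((S.arcMatrix ^ t).mulVec f) 0 ω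
      + ∑ s ∈ Finset.range t, S.inc ((S.arcMatrix ^ (t - 1 - s)).mulVec f) s ω := by
  induction t generalizing f with
  | zero => simp
  | succ t ih =>
    have h1 : S.wt f (t + 1) ω = S.wt (S.arcMatrix.mulVec f) t ω + S.inc f t ω := by
      rw [inc]; ring
    rw [h1, ih, Matrix.mulVec_mulVec, ← pow_succ, add_assoc, Finset.sum_range_succ]
    congr 1
    simp only [Nat.add_sub_cancel, Nat.sub_self, pow_zero, Matrix.one_mulVec]
    congr 1
    refine Finset.sum_congr rfl fun s hs => ?_
    have hs' := Finset.mem_range.mp hs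
    rw [Matrix.mulVec_mulVec, ← pow_succ, show t - 1 - s + 1 = t - s by omega]

/-- Convergence of the rescaled weights, when the deviations are summable after rescaling. -/
theorem exists_tendsto_wt_div {r : ℝ} {v : Fin n → ℝ} (hr : 0 < r)
    (ω : S.Sample) (hω : ∀ j, Summable fun t : ℕ =>
      ‖S.inc (fun i => if j = i then 1 else 0) t ω / r ^ t‖) :
    ∃ W : ℝ, ∀ (f : Fin n → ℝ) (c : ℝ),
      (∀ i, Tendsto (fun k : ℕ => (S.arcMatrix ^ k).mulVec f i / r ^ k) atTop (𝓝 (c * v i))) →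
        Tendsto (fun t : ℕ => S.wt f t ω / r ^ t) atTop (𝓝 (c * W)) := by
  set I : Fin n → ℕ → ℝ := fun j t => S.inc (fun i => if j = i then 1 else 0) t ω with hI
  -- The termwise limit with `c` factored out; the exponent `s + 1` is what remains of `r ^ t` after
  -- `r ^ (t - 1 - s)` has normalized the matrix power.
  refine ⟨(∑ j, ((S.realisation ω 0).chi j : ℝ) * v j) + ∑' s, ∑ j, v j * I j s / r ^ (s + 1),
    fun f c hf => ?_⟩
  have hb : ∀ j, ∃ B, ∀ k : ℕ, |(S.arcMatrix ^ k).mulVec f j / r ^ k| ≤ B := fun j => by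
    obtain ⟨B, hB⟩ := (hf j).abs.bddAbove_range
    exact ⟨B, fun k => hB ⟨k, rfl⟩⟩
  choose B hB using hb
  have hdecomp : ∀ t : ℕ, S.wt f t ω / r ^ t
      = (∑ j, ((S.realisation ω 0).chi j : ℝ) * ((S.arcMatrix ^ t).mulVec f j / r ^ t))
        + ∑' s, if s < t then ∑ j, (S.arcMatrix ^ (t - 1 - s)).mulVec f j / r ^ (t - 1 - s)
            * (I j s / r ^ (s + 1)) else 0 := by
    intro t
    rw [wt_eq_add_sum_inc, wt_eq_sum_chi, add_div, Finset.sum_div, Finset.sum_div]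
    congr 1
    · exact Finset.sum_congr rfl fun j _ => mul_div_assoc _ _ _
    · rw [tsum_eq_sum (s := Finset.range t)
        fun s hs => if_neg fun h => hs (Finset.mem_range.mpr h)]
      refine Finset.sum_congr rfl fun s hs => ?_
      have hs' := Finset.mem_range.mp hs
      rw [if_pos hs', inc_eq_sum_single, Finset.sum_div]
      refine Finset.sum_congr rfl fun j _ => ?_
      rw [div_mul_div_comm, ← pow_add, show t - 1 - s + (s + 1) = t by omega]
  have hlim : Tendsto (fun t : ℕ => ∑' s, if s < t then
      ∑ j, (S.arcMatrix ^ (t - 1 - s)).mulVec f j / r ^ (t - 1 - s) * (I j s / r ^ (s + 1)) else 0)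
      atTop (𝓝 (∑' s, ∑ j, c * v j * (I j s / r ^ (s + 1)))) := by
    refine tendsto_tsum_of_dominated_convergence
      (bound := fun s => ∑ j, B j * (‖I j s / r ^ s‖ * r⁻¹)) ?_ ?_ ?_
    · exact summable_sum fun j _ => ((hω j).mul_right _).mul_left _
    · intro s
      have h1 : Tendsto (fun t : ℕ => ∑ j, (S.arcMatrix ^ (t - 1 - s)).mulVec f j
          / r ^ (t - 1 - s) * (I j s / r ^ (s + 1))) atTop
          (𝓝 (∑ j, c * v j * (I j s / r ^ (s + 1)))) := by
        refine tendsto_finsetSum _ fun j _ => Tendsto.mul_const _ ?_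
        exact (hf j).comp ((tendsto_sub_atTop_nat s).comp (tendsto_sub_atTop_nat 1))
      refine h1.congr' ?_
      filter_upwards [eventually_gt_atTop s] with t ht
      rw [if_pos ht]
    · refine Eventually.of_forall fun t s => ?_
      have hterm : ∀ j, I j s / r ^ (s + 1) = I j s / r ^ s * r⁻¹ := fun j => by
        rw [pow_succ, div_mul_eq_div_div, div_eq_mul_inv (I j s / r ^ s)]
      have hB0 : ∀ j, 0 ≤ B j := fun j => (abs_nonneg _).trans (hB j 0)
      split_ifs
      · refine (norm_sum_le _ _).trans (Finset.sum_le_sum fun j _ => ?_)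
        rw [norm_mul, hterm, norm_mul, Real.norm_of_nonneg (inv_nonneg.mpr hr.le)]
        exact mul_le_mul_of_nonneg_right (hB j _)
          (mul_nonneg (norm_nonneg _) (inv_nonneg.mpr hr.le))
      · rw [norm_zero]
        exact Finset.sum_nonneg fun j _ =>
          mul_nonneg (hB0 j) (mul_nonneg (norm_nonneg _) (inv_nonneg.mpr hr.le))
  have hlim0 : Tendsto (fun t : ℕ => ∑ j, ((S.realisation ω 0).chi j : ℝ)
      * ((S.arcMatrix ^ t).mulVec f j / r ^ t)) atTop
      (𝓝 (∑ j, ((S.realisation ω 0).chi j : ℝ) * (c * v j))) :=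
    tendsto_finsetSum _ fun j _ => (hf j).const_mul _
  simp only [hdecomp]
  convert hlim0.add hlim using 2
  rw [mul_add, Finset.mul_sum, ← tsum_mul_left]
  congr 1
  · exact Finset.sum_congr rfl fun j _ => mul_left_comm _ _ _
  · refine tsum_congr fun s => ?_
    rw [Finset.mul_sum]
    exact Finset.sum_congr rfl fun j _ => by ring

/-! ### Second moments of the martingale. -/

section Moments

variable {S} {r : ℝ} {v : Fin n → ℝ}

theorem integral_mul_wt_add (hAv : S.arcMatrix.mulVec v = r • v) {t : ℕ} {φ : S.Sample → ℝ}
    (hφ : S.Past t φ) (k : ℕ) :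
    ∫ ω, φ ω * S.wt v (t + k) ω ∂S.law = r ^ k * ∫ ω, φ ω * S.wt v t ω ∂S.law := by
  induction k with
  | zero => simp
  | succ k ih =>
    rw [← add_assoc, integral_mul_wt_succ (hφ.mono (Nat.le_add_right t k)), hAv]
    simp only [wt_smul, mul_left_comm _ r]
    rw [integral_const_mul, ih, pow_succ']
    ring

theorem exists_integral_mul_inc_sq_le_pow (hv : ∀ i, 0 < v i)
    (hAv : S.arcMatrix.mulVec v = r • v) (f : Fin n → ℝ) : ∃ C : ℝ, 0 ≤ C ∧
    ∀ (t k : ℕ) (φ : S.Sample → ℝ), S.Past t φ → (∀ ω, 0 ≤ φ ω) →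
      ∫ ω, φ ω * S.inc f (t + k) ω ^ 2 ∂S.law ≤ C * r ^ k * ∫ ω, φ ω * S.wt v t ω ∂S.law := by
  obtain ⟨C, hC0, hC⟩ := S.exists_integral_mul_inc_sq_le f
  obtain ⟨ε, hε, hεv⟩ := Matrix.exists_pos_forall_mul_le hv (fun _ => 1)
  refine ⟨C * ε⁻¹, mul_nonneg hC0 (inv_nonneg.mpr hε.le), fun t k φ hφ hφ0 => ?_⟩
  have hφ' := hφ.mono (Nat.le_add_right t k)
  refine (hC (t + k) φ hφ' hφ0).trans ?_
  rw [mul_assoc, mul_assoc, ← integral_mul_wt_add hAv hφ]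
  refine mul_le_mul_of_nonneg_left ?_ hC0
  rw [← integral_const_mul]
  refine integral_mono (hφ'.mul (S.past_wt _ _)).integrable
    ((hφ'.mul (S.past_wt _ _)).integrable.const_mul _) fun ω => ?_
  beta_reduce
  rw [mul_left_comm, ← wt_smul S ε⁻¹ v]
  refine mul_le_mul_of_nonneg_left (S.wt_mono (fun i => ?_) _ ω) (hφ0 ω)
  rw [Pi.smul_apply, smul_eq_mul, ← div_eq_inv_mul, one_le_div hε]
  simpa using hεv i

theorem past_const (c : ℝ) : S.Past 0 fun _ => c := fun _ _ _ => rfl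

/-- The second moment of the deviation is `O(r ^ t)`, so after division by `r ^ t` its mean absolute
value is `O(r ^ (-t/2))`, which is summable. -/
theorem ae_summable_inc (hr : 1 < r) (hv : ∀ i, 0 < v i)
    (hAv : S.arcMatrix.mulVec v = r • v) (f : Fin n → ℝ) :
    ∀ᵐ ω ∂S.law, Summable fun t : ℕ => ‖S.inc f t ω / r ^ t‖ := by
  have hr0 : 0 < r := by linarith
  obtain ⟨C, hC0, hC⟩ := exists_integral_mul_inc_sq_le_pow hv hAv f
  set D := C * ∫ ω, 1 * S.wt v 0 ω ∂S.law
  set θ := √r with hθ_def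
  have hθ : 1 < θ := Real.lt_sqrt_of_sq_lt (by simpa using hr)
  have hθ0 : 0 < θ := by linarith
  have hθr : θ * θ = r := Real.mul_self_sqrt hr0.le
  have hinc : ∀ t, S.Past (t + 1) fun ω => S.inc f t ω / r ^ t := fun t =>
    (S.past_inc f t).comp fun x => x / r ^ t
  refine ae_summable_norm_of_summable_integral_norm (fun t => (hinc t).integrable) ?_
  refine Summable.of_nonneg_of_le (f := fun t : ℕ => (D + 1) * θ⁻¹ ^ t)
    (fun t => integral_nonneg fun ω => norm_nonneg _) (fun t => ?_)
    ((summable_geometric_of_lt_one (inv_nonneg.mpr hθ0.le) (inv_lt_one_of_one_lt₀ hθ)).mul_left _)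
  have hθt : 0 < θ ^ t := pow_pos hθ0 t
  have hsq : S.Past (t + 1) fun ω => S.inc f t ω ^ 2 := (S.past_inc f t).comp fun x => x ^ 2
  -- In place of Cauchy–Schwarz: `y ≤ a y² + 1 / a` with `a = θ ^ t`, which balances both terms
  -- since `θ² = r`.
  have h1 : ∀ ω, ‖S.inc f t ω / r ^ t‖ ≤ θ ^ t / (r ^ t) ^ 2 * S.inc f t ω ^ 2 + θ⁻¹ ^ t := by
    intro ω
    rw [div_mul_eq_mul_div, mul_div_assoc, ← div_pow, ← sq_abs (S.inc f t ω / r ^ t),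
      ← Real.norm_eq_abs]
    set y := ‖S.inc f t ω / r ^ t‖
    have hy : 0 ≤ y := norm_nonneg _
    have hinv : 0 < θ⁻¹ ^ t := pow_pos (inv_pos.mpr hθ0) t
    have hmul : θ ^ t * θ⁻¹ ^ t = 1 := by rw [← mul_pow, mul_inv_cancel₀ hθ0.ne', one_pow]
    have hmul' : θ⁻¹ ^ t * θ ^ t = 1 := by rw [mul_comm, hmul]
    rcases le_total y (θ⁻¹ ^ t) with h | h
    · have : 0 ≤ θ ^ t * y ^ 2 := by positivity
      linarith
    · have : 1 ≤ θ ^ t * y := by rw [← hmul]; exact mul_le_mul_of_nonneg_left h hθt.le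
      nlinarith
  calc ∫ ω, ‖S.inc f t ω / r ^ t‖ ∂S.law
      ≤ ∫ ω, (θ ^ t / (r ^ t) ^ 2 * S.inc f t ω ^ 2 + θ⁻¹ ^ t) ∂S.law :=
        integral_mono (hinc t).integrable.norm
          ((hsq.integrable.const_mul _).add (integrable_const _)) h1
    _ = θ ^ t / (r ^ t) ^ 2 * ∫ ω, 1 * S.inc f t ω ^ 2 ∂S.law + θ⁻¹ ^ t := by
        rw [integral_add (hsq.integrable.const_mul _) (integrable_const _), integral_const_mul]
        simp
    _ ≤ θ ^ t / (r ^ t) ^ 2 * (D * r ^ t) + θ⁻¹ ^ t := by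
        have := hC 0 t (fun _ => 1) (past_const 1) fun _ => zero_le_one
        rw [zero_add, mul_right_comm] at this
        gcongr
    _ = (D + 1) * θ⁻¹ ^ t := by
        rw [← hθr, inv_pow, mul_pow]
        field_simp

/-- Martingale increments are orthogonal, so their second moments add up to a geometric series; `K`
is its sum `∑ C / r ^ (k + 2)`. -/
theorem exists_integral_mul_sub_sq_le (hr : 1 < r) (hv : ∀ i, 0 < v i)
    (hAv : S.arcMatrix.mulVec v = r • v) : ∃ K : ℝ, 0 ≤ K ∧
    ∀ (t k : ℕ) (φ : S.Sample → ℝ), S.Past t φ → (∀ ω, 0 ≤ φ ω) →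
      ∫ ω, φ ω * (S.wt v (t + k) ω / r ^ k - S.wt v t ω) ^ 2 ∂S.law
        ≤ K * ∫ ω, φ ω * S.wt v t ω ∂S.law := by
  have hr0 : 0 < r := by linarith
  obtain ⟨C, hC0, hC⟩ := exists_integral_mul_inc_sq_le_pow hv hAv v
  set K := C / (r * (r - 1)) with hK
  have hK0 : 0 ≤ K := div_nonneg hC0 (mul_nonneg hr0.le (by linarith))
  refine ⟨K, hK0, fun t k φ hφ hφ0 => ?_⟩
  set E := ∫ ω, φ ω * S.wt v t ω ∂S.law with hE
  have hE0 : 0 ≤ E := integral_nonneg fun ω =>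
    mul_nonneg (hφ0 ω) (S.wt_nonneg (fun i => (hv i).le) t ω)
  -- Keeping the exact partial sum lets the induction close.
  suffices h : ∫ ω, φ ω * (S.wt v (t + k) ω / r ^ k - S.wt v t ω) ^ 2 ∂S.law
      ≤ K * (1 - 1 / r ^ k) * E by
    refine h.trans (mul_le_mul_of_nonneg_right (mul_le_of_le_one_right hK0 ?_) hE0)
    have : 0 ≤ 1 / r ^ k := by positivity
    linarith
  induction k with
  | zero => simp
  | succ k ih =>
    have hφk := hφ.mono (Nat.le_add_right t k)
    set d : S.Sample → ℝ := fun ω => S.wt v (t + k) ω / r ^ k - S.wt v t ω with hd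
    have hdp : S.Past (t + k) d :=
      ((S.past_wt v (t + k)).comp fun x => x / r ^ k).sub
        ((S.past_wt v t).mono (Nat.le_add_right t k))
    have hexp : ∀ ω, φ ω * (S.wt v (t + (k + 1)) ω / r ^ (k + 1) - S.wt v t ω) ^ 2
        = φ ω * d ω ^ 2 + 2 / r ^ (k + 1) * (φ ω * d ω * S.inc v (t + k) ω)
          + 1 / (r ^ (k + 1)) ^ 2 * (φ ω * S.inc v (t + k) ω ^ 2) := by
      intro ω
      have h1 : S.wt v (t + (k + 1)) ω = r * S.wt v (t + k) ω + S.inc v (t + k) ω := by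
        rw [inc, hAv, wt_smul, ← add_assoc]; ring
      rw [h1, hd]
      field_simp
      ring
    have hi1 : Integrable (fun ω => φ ω * d ω ^ 2) S.law :=
      (hφk.mul (hdp.comp fun x => x ^ 2)).integrable
    have hi2 : Integrable (fun ω => φ ω * d ω * S.inc v (t + k) ω) S.law :=
      (((hφk.mul hdp).mono (Nat.le_succ _)).mul (S.past_inc v (t + k))).integrable
    have hi3 : Integrable (fun ω => φ ω * S.inc v (t + k) ω ^ 2) S.law :=
      ((hφk.mono (Nat.le_succ _)).mul ((S.past_inc v (t + k)).comp fun x => x ^ 2)).integrable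
    simp only [hexp]
    have hi12 : Integrable (fun ω => φ ω * d ω ^ 2
        + 2 / r ^ (k + 1) * (φ ω * d ω * S.inc v (t + k) ω)) S.law := hi1.add (hi2.const_mul _)
    rw [integral_add hi12 (hi3.const_mul _),
      integral_add hi1 (hi2.const_mul _), integral_const_mul, integral_const_mul,
      integral_mul_inc (hφk.mul hdp), mul_zero, add_zero]
    have h3 := mul_le_mul_of_nonneg_left (hC t k φ hφ hφ0)
      (show 0 ≤ 1 / (r ^ (k + 1)) ^ 2 by positivity)
    refine (add_le_add ih h3).trans (le_of_eq ?_)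
    have hr1 : r - 1 ≠ 0 := by linarith
    rw [hK, ← hE]
    field_simp
    ring

end Moments

/-! ### Monotonicity of the number of arcs. -/

section NonEmpty

variable {S}

theorem ae_prob_ne_zero : ∀ᵐ ω ∂S.law, ∀ s : S.Label × Fin n, S.p s.2 (ω s) ≠ 0 := by
  rw [ae_all_iff]
  intro s
  have h1 : ∀ᵐ k ∂(S.p s.2).toMeasure, S.p s.2 k ≠ 0 := by
    rw [ae_iff, PMF.toMeasure_apply_eq_zero_iff _ (Set.toFinite _).measurableSet]
    rw [Set.disjoint_left]
    intro k hk hk'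
    exact hk' ((PMF.mem_support_iff _ _).mp hk)
  rw [← Measure.infinitePi_map_eval (fun s : S.Label × Fin n => (S.p s.2).toMeasure) s] at h1
  exact ae_of_ae_map (measurable_pi_apply s).aemeasurable h1

theorem _root_.ColoredNetwork.one_le_weight_one (G : ColoredNetwork n) (h : Nonempty G.E) :
    1 ≤ G.weight fun _ => 1 := by
  rw [ColoredNetwork.weight_one, ColoredNetwork.numArcs]
  exact_mod_cast Nat.card_pos

theorem ae_monotone_wt_one
    (hR : ∀ (i : Fin n) (k : Fin (S.q i)), S.p i k ≠ 0 → Nonempty (S.R i k).E) :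
    ∀ᵐ ω ∂S.law, Monotone fun t => S.wt (fun _ => 1) t ω := by
  filter_upwards [ae_prob_ne_zero (S := S)] with ω hω
  refine monotone_nat_of_le_succ fun t => ?_
  rw [wt_succ, wt_eq_sum]
  exact Finset.sum_le_sum fun s _ => mul_le_mul_of_nonneg_left
    (ColoredNetwork.one_le_weight_one _ (hR _ _ (hω s))) (S.alive_nonneg t s ω)

theorem one_le_arcMatrix_mulVec_one
    (hR : ∀ (i : Fin n) (k : Fin (S.q i)), S.p i k ≠ 0 → Nonempty (S.R i k).E)
    (i : Fin n) : 1 ≤ (S.arcMatrix.mulVec fun _ => 1) i := by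
  rw [← sum_prob_mul_weight]
  refine (S.sum_prob i).ge.trans (Finset.sum_le_sum fun k _ => ?_)
  rcases eq_or_ne (S.p i k) 0 with h | h
  · simp [h]
  · exact le_mul_of_one_le_right ENNReal.toReal_nonneg
      (ColoredNetwork.one_le_weight_one _ (hR _ _ h))

end NonEmpty

end SubstitutionSystem

/-! ### The limit is almost surely nonzero. -/

namespace SubstitutionSystem

variable {n : ℕ} {S : SubstitutionSystem n}

theorem one_le_wt_one_zero (hG0 : Nonempty S.G0.E) (ω : S.Sample) : 1 ≤ S.wt (fun _ => 1) 0 ω :=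
  ColoredNetwork.one_le_weight_one _ hG0

theorem exists_wt_succ_le {v : Fin n → ℝ} (hv : ∀ i, 0 < v i) :
    ∃ B : ℝ, 0 ≤ B ∧ ∀ t ω, S.wt v (t + 1) ω ≤ B * S.wt (fun _ => 1) t ω := by
  have h0 : ∀ i k, 0 ≤ (S.R i k).weight v := fun i k =>
    ColoredNetwork.weight_nonneg _ fun j => (hv j).le
  refine ⟨∑ i, ∑ k, (S.R i k).weight v,
    Finset.sum_nonneg fun i _ => Finset.sum_nonneg fun k _ => h0 i k, fun t ω => ?_⟩
  rw [wt_succ, wt_eq_sum, Finset.mul_sum]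
  refine Finset.sum_le_sum fun s _ => ?_
  rw [mul_one, mul_comm]
  refine mul_le_mul_of_nonneg_right ?_ (S.alive_nonneg t s ω)
  exact (Finset.single_le_sum (f := fun k => (S.R s.2 k).weight v) (fun k _ => h0 s.2 k)
      (Finset.mem_univ (ω s))).trans
    (Finset.single_le_sum (f := fun i => ∑ k, (S.R i k).weight v)
      (fun i _ => Finset.sum_nonneg fun k _ => h0 i k) (Finset.mem_univ s.2))

/-- The events "at most `L` arcs" decrease in `t`. The `v`-weight carried by them would grow by the
factor `r` each step, yet it stays bounded and loses at most `B * L` times the probability that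
leaves. Telescoping makes these probabilities summable. -/
theorem tendsto_integral_wt_one_le (hG0 : Nonempty S.G0.E)
    (hR : ∀ (i : Fin n) (k : Fin (S.q i)), S.p i k ≠ 0 → Nonempty (S.R i k).E)
    {r : ℝ} {v : Fin n → ℝ} (hr : 1 < r) (hv : ∀ i, 0 < v i)
    (hAv : S.arcMatrix.mulVec v = r • v) {L : ℝ} (hL : 0 ≤ L) :
    Tendsto (fun t => ∫ ω, (if S.wt (fun _ => 1) t ω ≤ L then (1 : ℝ) else 0) ∂S.law)
      atTop (𝓝 0) := by
  obtain ⟨B, hB0, hB⟩ := exists_wt_succ_le (S := S) hv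
  obtain ⟨ε, hε, hεv⟩ := Matrix.exists_pos_forall_mul_le hv (fun _ => 1)
  obtain ⟨δ, hδ, hδv⟩ := Matrix.exists_pos_forall_mul_le (fun _ : Fin n => one_pos) v
  set φ : ℕ → S.Sample → ℝ := fun t ω => if S.wt (fun _ => 1) t ω ≤ L then (1 : ℝ) else 0
    with hφ_def
  have hφ : ∀ t, S.Past t (φ t) := fun t =>
    (S.past_wt (fun _ => 1) t).comp fun x => if x ≤ L then (1 : ℝ) else 0
  have hφ0 : ∀ t ω, 0 ≤ φ t ω := fun t ω => by simp only [hφ_def]; split_ifs <;> norm_num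
  have hφ1 : ∀ t ω, φ t ω ≤ 1 := fun t ω => by simp only [hφ_def]; split_ifs <;> norm_num
  set e : ℕ → ℝ := fun t => ∫ ω, φ t ω * S.wt v t ω ∂S.law with he
  set p : ℕ → ℝ := fun t => ∫ ω, φ t ω ∂S.law with hp
  have hp0 : ∀ t, 0 ≤ p t := fun t => integral_nonneg (hφ0 t)
  have hp1 : ∀ t, p t ≤ 1 := fun t => by
    refine (integral_mono (hφ t).integrable (integrable_const 1) (hφ1 t)).trans ?_
    simp
  have heub : ∀ t, e t ≤ δ⁻¹ * L := fun t => by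
    refine (integral_mono ((hφ t).mul (S.past_wt v t)).integrable
      (integrable_const (δ⁻¹ * L)) fun ω => ?_).trans (by simp)
    have h1 : S.wt v t ω ≤ δ⁻¹ * S.wt (fun _ => 1) t ω := by
      rw [← wt_smul]
      refine S.wt_mono (fun i => ?_) t ω
      rw [Pi.smul_apply, smul_eq_mul, mul_one, ← one_div, le_div_iff₀ hδ, mul_comm]
      exact hδv i
    simp only [hφ_def]
    split_ifs with h
    · rw [one_mul]
      exact h1.trans (mul_le_mul_of_nonneg_left h (inv_nonneg.mpr hδ.le))
    · rw [zero_mul]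
      positivity
  have hpe : ∀ t, ε * p t ≤ e t := fun t => by
    rw [hp, ← integral_const_mul]
    refine integral_mono_ae ((hφ t).integrable.const_mul _)
      ((hφ t).mul (S.past_wt v t)).integrable ?_
    filter_upwards [ae_monotone_wt_one hR] with ω hω
    rw [mul_comm]
    refine mul_le_mul_of_nonneg_left ?_ (hφ0 t ω)
    have h1 : 1 ≤ S.wt (fun _ => 1) t ω := (one_le_wt_one_zero hG0 ω).trans (hω (Nat.zero_le t))
    calc ε ≤ ε * S.wt (fun _ => 1) t ω := le_mul_of_one_le_right hε.le h1
      _ = S.wt (ε • fun _ => 1) t ω := (S.wt_smul _ _ t ω).symm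
      _ ≤ S.wt v t ω := S.wt_mono hεv t ω
  -- A sample leaving the event at this step had at most `L` arcs before, hence weight at most `B *
  -- L` after.
  have hrec : ∀ t, r * e t ≤ e (t + 1) + B * L * (p t - p (t + 1)) := fun t => by
    have h1 : r * e t = ∫ ω, φ t ω * S.wt v (t + 1) ω ∂S.law := by
      rw [integral_mul_wt_add hAv (hφ t) 1, pow_one]
    have hi1 := ((hφ t).mono (Nat.le_succ t)).mul (S.past_wt v (t + 1)) |>.integrable
    have hi2 := ((hφ (t + 1)).mul (S.past_wt v (t + 1))).integrable
    have hi3 := ((hφ t).mono (Nat.le_succ t)).sub (hφ (t + 1)) |>.integrable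
    rw [h1, hp, ← integral_sub (hφ t).integrable (hφ (t + 1)).integrable,
      ← integral_const_mul, ← integral_add hi2 (hi3.const_mul _)]
    refine integral_mono_ae hi1 (hi2.add (hi3.const_mul _)) ?_
    filter_upwards [ae_monotone_wt_one hR] with ω hω
    have hmon := hω (Nat.le_succ t)
    simp only [Nat.succ_eq_add_one] at hmon
    have hstep := hB t ω
    have h0 := S.wt_nonneg (fun i => (hv i).le) (t + 1) ω
    simp only [hφ_def]
    split_ifs with h2 h3 h3
    · linarith
    · have := mul_le_mul_of_nonneg_left h2 hB0
      linarith
    · exact absurd (hmon.trans h3) h2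
    · linarith
  have hsum : ∀ T, ∑ t ∈ Finset.range T, (r - 1) * e t ≤ e T - e 0 + B * L * (p 0 - p T) := by
    intro T
    induction T with
    | zero => simp
    | succ T ih =>
      rw [Finset.sum_range_succ]
      have := hrec T
      linarith
  have hr1 : 0 < r - 1 := by linarith
  have hps : Summable p := by
    refine summable_of_sum_range_le (c := (δ⁻¹ * L + B * L) / ((r - 1) * ε)) hp0 fun T => ?_
    rw [le_div_iff₀ (mul_pos hr1 hε), Finset.sum_mul]
    have h1 : ∑ t ∈ Finset.range T, p t * ((r - 1) * ε) ≤ ∑ t ∈ Finset.range T, (r - 1) * e t :=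
      Finset.sum_le_sum fun t _ => by
        rw [mul_left_comm, mul_comm (p t)]
        exact mul_le_mul_of_nonneg_left (hpe t) hr1.le
    have h2 : 0 ≤ e 0 := (mul_nonneg hε.le (hp0 0)).trans (hpe 0)
    have h3 : B * L * (p 0 - p T) ≤ B * L :=
      mul_le_of_le_one_right (mul_nonneg hB0 hL) (by linarith [hp1 0, hp0 T])
    linarith [hsum T, heub T]
  exact hps.tendsto_atTop_zero

/-- Where the limit is 0, the squared relative deviation `F k` from the weight at time `t` tends to
1. Markov, Fatou and the variance bound with `φ` the inverse square weight then give the estimate.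
-/
theorem measure_tendsto_zero_le (hG0 : Nonempty S.G0.E)
    (hR : ∀ (i : Fin n) (k : Fin (S.q i)), S.p i k ≠ 0 → Nonempty (S.R i k).E)
    {r : ℝ} {v : Fin n → ℝ} (hr : 1 < r) (hv : ∀ i, 0 < v i)
    (hAv : S.arcMatrix.mulVec v = r • v) : ∃ K : ℝ, 0 ≤ K ∧ ∀ t,
      S.law {ω | Tendsto (fun s => S.wt v s ω / r ^ s) atTop (𝓝 0)}
        ≤ ENNReal.ofReal (K * ∫ ω, (S.wt v t ω)⁻¹ ∂S.law) := by
  have hr0 : 0 < r := by linarith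
  obtain ⟨K, hK0, hK⟩ := exists_integral_mul_sub_sq_le hr hv hAv
  obtain ⟨ε, hε, hεv⟩ := Matrix.exists_pos_forall_mul_le hv (fun _ => 1)
  refine ⟨K, hK0, fun t => ?_⟩
  set φ : S.Sample → ℝ := fun ω => (S.wt v t ω)⁻¹ ^ 2 with hφ_def
  have hφ : S.Past t φ := (S.past_wt v t).comp fun x => x⁻¹ ^ 2
  set F : ℕ → S.Sample → ℝ := fun k ω =>
    φ ω * (S.wt v (t + k) ω / r ^ k - S.wt v t ω) ^ 2 with hF
  have hF0 : ∀ k ω, 0 ≤ F k ω := fun k ω => mul_nonneg (sq_nonneg _) (sq_nonneg _)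
  have hFp : ∀ k, S.Past (t + k) (F k) := fun k =>
    (hφ.mono (Nat.le_add_right t k)).mul
      (((((S.past_wt v (t + k)).comp fun x => x / r ^ k).sub
        ((S.past_wt v t).mono (Nat.le_add_right t k)))).comp fun x => x ^ 2)
  have hsub : ∀ᵐ ω ∂S.law, ω ∈ {ω | Tendsto (fun s => S.wt v s ω / r ^ s) atTop (𝓝 0)} →
      ω ∈ {ω | 1 ≤ liminf (fun k => ENNReal.ofReal (F k ω)) atTop} := by
    filter_upwards [ae_monotone_wt_one hR] with ω hω hlim
    have h1 : 1 ≤ S.wt (fun _ => 1) t ω := (one_le_wt_one_zero hG0 ω).trans (hω (Nat.zero_le t))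
    have hpos : 0 < S.wt v t ω := by
      calc 0 < ε * S.wt (fun _ => 1) t ω := by positivity
        _ = S.wt (ε • fun _ => 1) t ω := (S.wt_smul _ _ t ω).symm
        _ ≤ S.wt v t ω := S.wt_mono hεv t ω
    have h2 : Tendsto (fun k => S.wt v (t + k) ω / r ^ k) atTop (𝓝 0) := by
      have h3 := ((show Tendsto (fun s => S.wt v s ω / r ^ s) atTop (𝓝 0) from hlim).comp
        (tendsto_add_atTop_nat t)).mul_const (r ^ t)
      rw [zero_mul] at h3
      refine h3.congr fun k => ?_
      rw [Function.comp, add_comm k t, pow_add]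
      field_simp
    have h3 : Tendsto (fun k => F k ω) atTop (𝓝 (φ ω * (0 - S.wt v t ω) ^ 2)) :=
      ((h2.sub_const _).pow 2).const_mul _
    have h4 : φ ω * (0 - S.wt v t ω) ^ 2 = 1 := by
      simp only [hφ_def]
      field_simp
      ring
    rw [h4] at h3
    have h5 := (ENNReal.tendsto_ofReal h3).liminf_eq
    change 1 ≤ liminf (fun k => ENNReal.ofReal (F k ω)) atTop
    rw [h5, ENNReal.ofReal_one]
  have hm : ∀ k, Measurable fun ω => ENNReal.ofReal (F k ω) := fun k =>
    (hFp k).measurable.ennreal_ofReal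
  calc S.law {ω | Tendsto (fun s => S.wt v s ω / r ^ s) atTop (𝓝 0)}
      ≤ S.law {ω | 1 ≤ liminf (fun k => ENNReal.ofReal (F k ω)) atTop} := measure_mono_ae hsub
    _ ≤ ∫⁻ ω, liminf (fun k => ENNReal.ofReal (F k ω)) atTop ∂S.law := by
        have := mul_meas_ge_le_lintegral (μ := S.law) (Measurable.liminf hm) 1
        rwa [one_mul] at this
    _ ≤ liminf (fun k => ∫⁻ ω, ENNReal.ofReal (F k ω) ∂S.law) atTop := lintegral_liminf_le hm
    _ ≤ ENNReal.ofReal (K * ∫ ω, (S.wt v t ω)⁻¹ ∂S.law) := by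
        refine liminf_le_of_frequently_le' (Eventually.of_forall fun k => ?_).frequently
        rw [← ofReal_integral_eq_lintegral_ofReal (hFp k).integrable
          (Eventually.of_forall (hF0 k))]
        refine ENNReal.ofReal_le_ofReal ((hK t k φ hφ fun ω => sq_nonneg _).trans (le_of_eq ?_))
        congr 2
        funext ω
        simp only [hφ_def]
        -- At weight 0 both sides vanish because `0⁻¹ = 0`.
        rcases eq_or_ne (S.wt v t ω) 0 with h | h
        · simp [h]
        · field_simp

/-- The inverse weight is at most `ε⁻¹` always and at most `ε⁻¹ / L` when there are more than `L`
arcs; the remaining event has vanishing probability. -/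
theorem tendsto_integral_inv_wt (hG0 : Nonempty S.G0.E)
    (hR : ∀ (i : Fin n) (k : Fin (S.q i)), S.p i k ≠ 0 → Nonempty (S.R i k).E)
    {r : ℝ} {v : Fin n → ℝ} (hr : 1 < r) (hv : ∀ i, 0 < v i)
    (hAv : S.arcMatrix.mulVec v = r • v) :
    Tendsto (fun t => ∫ ω, (S.wt v t ω)⁻¹ ∂S.law) atTop (𝓝 0) := by
  obtain ⟨ε, hε, hεv⟩ := Matrix.exists_pos_forall_mul_le hv (fun _ => 1)
  have hbound : ∀ L : ℝ, 0 < L → ∀ t, ∫ ω, (S.wt v t ω)⁻¹ ∂S.law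
      ≤ ε⁻¹ * L⁻¹ + ε⁻¹ * ∫ ω, (if S.wt (fun _ => 1) t ω ≤ L then (1 : ℝ) else 0) ∂S.law := by
    intro L hL t
    have hφ : S.Past t fun ω => if S.wt (fun _ => 1) t ω ≤ L then (1 : ℝ) else 0 :=
      (S.past_wt (fun _ => 1) t).comp fun x => if x ≤ L then (1 : ℝ) else 0
    have hinv : S.Past t fun ω => (S.wt v t ω)⁻¹ := (S.past_wt v t).comp fun x => x⁻¹
    have hc : ε⁻¹ * L⁻¹ = ∫ _ : S.Sample, ε⁻¹ * L⁻¹ ∂S.law := by simp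
    rw [hc, ← integral_const_mul,
      ← integral_add (integrable_const _) (hφ.integrable.const_mul _)]
    refine integral_mono_ae hinv.integrable
      ((integrable_const _).add (hφ.integrable.const_mul _)) ?_
    filter_upwards [ae_monotone_wt_one hR] with ω hω
    have h1 : 1 ≤ S.wt (fun _ => 1) t ω := (one_le_wt_one_zero hG0 ω).trans (hω (Nat.zero_le t))
    have h2 : ε * S.wt (fun _ => 1) t ω ≤ S.wt v t ω := by
      rw [← wt_smul]
      exact S.wt_mono hεv t ω
    have h3 : (S.wt v t ω)⁻¹ ≤ ε⁻¹ * (S.wt (fun _ => 1) t ω)⁻¹ := by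
      rw [← mul_inv]
      exact inv_anti₀ (by positivity) h2
    refine h3.trans ?_
    rw [← mul_add]
    refine mul_le_mul_of_nonneg_left ?_ (inv_nonneg.mpr hε.le)
    split_ifs with h
    · have := inv_le_one_of_one_le₀ h1
      have : 0 ≤ L⁻¹ := inv_nonneg.mpr hL.le
      linarith
    · rw [add_zero]
      exact inv_anti₀ hL (not_le.mp h).le
  have hnn : ∀ t, 0 ≤ ∫ ω, (S.wt v t ω)⁻¹ ∂S.law := fun t =>
    integral_nonneg fun ω => inv_nonneg.mpr (S.wt_nonneg (fun i => (hv i).le) t ω)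
  rw [tendsto_order]
  refine ⟨fun a ha => Eventually.of_forall fun t => ha.trans_le (hnn t), fun a ha => ?_⟩
  set L : ℝ := 2 / (ε * a) with hL
  have hL0 : 0 < L := by positivity
  have h1 : ε⁻¹ * L⁻¹ = a / 2 := by
    rw [hL]
    field_simp
  have h2 := (tendsto_integral_wt_one_le hG0 hR hr hv hAv hL0.le).const_mul ε⁻¹
  rw [mul_zero] at h2
  filter_upwards [h2.eventually_lt_const (half_pos ha)] with t ht
  have := hbound L hL0 t
  linarith

theorem ae_not_tendsto_zero (hG0 : Nonempty S.G0.E)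
    (hR : ∀ (i : Fin n) (k : Fin (S.q i)), S.p i k ≠ 0 → Nonempty (S.R i k).E)
    {r : ℝ} {v : Fin n → ℝ} (hr : 1 < r) (hv : ∀ i, 0 < v i)
    (hAv : S.arcMatrix.mulVec v = r • v) :
    ∀ᵐ ω ∂S.law, ¬ Tendsto (fun s => S.wt v s ω / r ^ s) atTop (𝓝 0) := by
  obtain ⟨K, -, hK⟩ := measure_tendsto_zero_le hG0 hR hr hv hAv
  have h1 := ENNReal.tendsto_ofReal ((tendsto_integral_inv_wt hG0 hR hr hv hAv).const_mul K)
  rw [mul_zero, ENNReal.ofReal_zero] at h1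
  rw [ae_iff]
  simp only [not_not]
  exact le_antisymm (ge_of_tendsto' h1 hK) zero_le

/-- The increments of the arc count are almost surely nonnegative and have mean zero. -/
theorem ae_wt_one_succ_eq
    (hR : ∀ (i : Fin n) (k : Fin (S.q i)), S.p i k ≠ 0 → Nonempty (S.R i k).E)
    (hM : (S.arcMatrix.mulVec fun _ => 1) = fun _ => 1) :
    ∀ᵐ ω ∂S.law, ∀ t, S.wt (fun _ => 1) (t + 1) ω = S.wt (fun _ => 1) t ω := by
  rw [ae_all_iff]
  intro t
  have h1 := integral_mul_inc ((past_const 1).mono (Nat.zero_le t)) (S := S) (fun _ => 1)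
  simp only [one_mul] at h1
  have h2 : 0 ≤ᵐ[S.law] S.inc (fun _ => 1) t := by
    filter_upwards [ae_monotone_wt_one hR] with ω hω
    rw [inc, hM]
    exact sub_nonneg.mpr (hω (Nat.le_succ t))
  filter_upwards [(integral_eq_zero_iff_of_nonneg_ae h2 (S.past_inc _ t).integrable).mp h1]
    with ω hω
  rw [inc, hM] at hω
  exact sub_eq_zero.mp hω

end SubstitutionSystem

theorem mainTheorem4 (n : ℕ) (S : SubstitutionSystem n)
    (hM : S.arcMatrix.IsPrimitive)
    (hG0 : Nonempty S.G0.E)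
    (hR : ∀ (i : Fin n) (k : Fin (S.q i)), S.p i k ≠ 0 → Nonempty (S.R i k).E) :
    ∀ᵐ ω ∂S.law,
      AsympConst atTop (fun t : ℕ => ((S.realisation ω t).numArcs : ℝ))
        (fun t : ℕ => S.arcMatrix.specRadius ^ t) := by
  have : Nonempty (Fin n) := hG0.map S.G0.col
  obtain ⟨r, v, hr, hv, hAv⟩ := hM.exists_pos_eigenvector
  rw [Matrix.specRadius_eq_of_pos_eigenvector hM.nonneg hr hv hAv]
  simp only [← ColoredNetwork.weight_one]
  have hone := SubstitutionSystem.one_le_arcMatrix_mulVec_one hR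
  rcases (Matrix.one_le_of_pos_eigenvector hM.nonneg hone hv hAv).eq_or_lt with rfl | hr1
  · rw [one_smul] at hAv
    filter_upwards [SubstitutionSystem.ae_wt_one_succ_eq hR (hM.mulVec_one_eq_one hone hv hAv)]
      with ω hω
    have hconst : ∀ t, S.wt (fun _ => 1) t ω = S.wt (fun _ => 1) 0 ω := fun t => by
      induction t with
      | zero => rfl
      | succ t ih => rw [hω, ih]
    refine ⟨S.wt (fun _ => 1) 0 ω,
      one_pos.trans_le (SubstitutionSystem.one_le_wt_one_zero hG0 ω), ?_⟩
    refine tendsto_const_nhds.congr fun t => ?_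
    beta_reduce
    rw [one_pow, div_one]
    exact (hconst t).symm
  · obtain ⟨c, hc, hlim⟩ := hM.tendsto_pow_mulVec hr hv hAv (fun _ => 1)
    have hc0 : 0 < c := hc (fun _ => zero_le_one) fun h =>
      one_ne_zero (congrFun h (Classical.arbitrary (Fin n)))
    -- With `f = v` the constant is 1, so `W` is the martingale limit itself: nonnegative, and
    -- nonzero by `ae_not_tendsto_zero`.
    have hlimv : ∀ i, Tendsto (fun k : ℕ => (S.arcMatrix ^ k).mulVec v i / r ^ k) atTop
        (𝓝 (1 * v i)) := fun i => by
      refine tendsto_const_nhds.congr fun k => ?_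
      rw [Matrix.pow_mulVec_of_eigen hAv, Pi.smul_apply, smul_eq_mul, one_mul,
        mul_div_cancel_left₀ _ (pow_pos hr k).ne']
    filter_upwards [SubstitutionSystem.ae_not_tendsto_zero hG0 hR hr1 hv hAv,
      ae_all_iff.mpr fun j => SubstitutionSystem.ae_summable_inc hr1 hv hAv
        (fun i => if j = i then 1 else 0)] with ω h1 h2
    obtain ⟨W, hW⟩ := S.exists_tendsto_wt_div (v := v) hr ω h2
    have hWv := hW v 1 hlimv
    rw [one_mul] at hWv
    have hW0 : 0 ≤ W := ge_of_tendsto' hWv fun t =>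
      div_nonneg (S.wt_nonneg (fun i => (hv i).le) t ω) (pow_nonneg hr.le t)
    have hWne : W ≠ 0 := by
      rintro rfl
      exact h1 hWv
    exact ⟨c * W, mul_pos hc0 (lt_of_le_of_ne hW0 hWne.symm), hW _ c hlim⟩
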